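/- All graphs are finite, undirected and simple, and $G$ has at least one vertex. A \emph{drawing} of a graph represents the vertices by distinct points of the plane and each edge by a simple curve between its endpoints, such that an edge contains no vertex other than its own endpoints, and no three edges intersect at a common point except at a common endpoint. A \emph{crossing} is a point of intersection between two edges other than a common endpoint. A graph is \emph{planar} if it has a drawing with no crossings. The \emph{crossing number} of a graph is the minimum number of crossings in a drawing of it, and the \emph{minor crossing number} $\mathrm{mcr}(G)$ is the minimum crossing number of a graph that contains $G$ as a minor. A \emph{decomposition} of $G$ is a graph $D$ each of whose vertices is assigned a set of vertices of $G$, called a \emph{bag} (distinct vertices of $D$ may have equal bags), such that: (i) for each vertex $v$ of $G$, the subgraph $D(v)$ of $D$ induced by the vertices whose bags contain $v$ is connected and non-empty; and (ii) for each edge $vw$ of $G$, the subgraphs $D(v)$ and $D(w)$ have a common vertex or are joined by an edge of $D$. The decomposition is \emph{planar} if $D$ is planar, and its \emph{width} is the maximum cardinality of a bag. Let $\Delta(D)$ be the maximum degree of $D$ and $|V(D)|$ its number of vertices. \textbf{Lemma.} If $D$ is a planar decomposition of $G$ of width $k$, then $$\mathrm{mcr}(G) < k^3(k+1)(\Delta(D)+1)^2\,|V(D)|.$$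 -/

import Mathlib

namespace SimpleGraph

/-! ### Drawings, planarity and the crossing number -/

/-- The Euclidean plane. -/
abbrev Plane : Type := EuclideanSpace ℝ (Fin 2)

/-- A drawing of a graph in the plane: distinct points for the vertices and, for each edge, a simple
curve between its endpoints, that contains no vertex other than its own endpoints; no three edges
intersect at a common point, except at a common endpoint. -/
structure Drawing {V : Type*} (G : SimpleGraph V) where
  /-- The point that represents a vertex. -/
  point : V → Plane
  /-- A parametrisation of the curve that represents an edge. -/
  curve : G.edgeSet → unitInterval → Plane
  point_injective : Function.Injective point
  curve_continuous : ∀ e, Continuous (curve e)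
  curve_injective : ∀ e, Function.Injective (curve e)
  curve_ends : ∀ e, s(curve e 0, curve e 1) = Sym2.map point e.1
  vertex_on_curve : ∀ e v, point v ∈ Set.range (curve e) → v ∈ e.1
  no_three_edges : ∀ e f g, e ≠ f → f ≠ g → e ≠ g →
    ∀ p, p ∈ Set.range (curve e) → p ∈ Set.range (curve f) → p ∈ Set.range (curve g) →
      ∃ v, v ∈ e.1 ∧ v ∈ f.1 ∧ v ∈ g.1 ∧ p = point v

/-- The crossings of a drawing: the points of intersection between two edges, other than a common
endpoint of the two. -/
def Drawing.crossings {V : Type*} {G : SimpleGraph V} (d : Drawing G) : Set Plane :=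
  {p | ∃ e f, e ≠ f ∧ p ∈ Set.range (d.curve e) ∧ p ∈ Set.range (d.curve f) ∧
    ¬ ∃ v, v ∈ e.1 ∧ v ∈ f.1 ∧ p = d.point v}

/-- A graph is planar if it has a crossing-free drawing. -/
def IsPlanar {V : Type*} (G : SimpleGraph V) : Prop :=
  ∃ d : Drawing G, d.crossings = ∅

/-- The crossing number: the minimum number of crossings in a drawing. (It is `⊤` if no
drawing has finitely many crossings.) -/
noncomputable def crossingNumber {V : Type*} (G : SimpleGraph V) : ℕ∞ :=
  ⨅ d : Drawing G, d.crossings.encard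

/-! ### Minors and the minor crossing number -/

/-- The graph obtained from `G` by contracting the edges of `G` that lie in `F`. Vertices joined by
a walk of contracted edges are identified, loops are deleted and parallel edges merged. -/
def contractEdges {V : Type*} (G : SimpleGraph V) (F : Set (Sym2 V)) :
    SimpleGraph (fromEdgeSet (F ∩ G.edgeSet)).ConnectedComponent where
  Adj a b := a ≠ b ∧ ∃ x y, G.Adj x y ∧ connectedComponentMk _ x = a ∧ connectedComponentMk _ y = b
  symm := ⟨by
    rintro a b ⟨hab, x, y, hxy, hx, hy⟩
    exact ⟨hab.symm, y, x, hxy.symm, hy, hx⟩⟩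
  loopless := ⟨fun _ h => h.1 rfl⟩

/-- `H` is a minor of `G`: up to isomorphism, `H` is obtained from a subgraph of `G` by contracting
edges. -/
def IsMinor {W V : Type*} (H : SimpleGraph W) (G : SimpleGraph V) : Prop :=
  ∃ (S : G.Subgraph) (F : Set (Sym2 S.verts)), Nonempty (H ≃g S.coe.contractEdges F)

/-- The minor crossing number of `G`: the minimum crossing number of a finite graph that contains
`G` as a minor. (Up to isomorphism the vertex set of a finite graph is `Fin n`.) -/
noncomputable def minorCrossingNumber {V : Type*} (G : SimpleGraph V) : ℕ∞ :=
  ⨅ (n : ℕ) (G' : SimpleGraph (Fin n)) (_ : IsMinor G G'), crossingNumber G'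

/-! ### Decompositions -/

/-- Two subgraphs touch if they have a common vertex or the ambient graph has an edge between
them. -/
def Subgraph.Touch {B : Type*} {D : SimpleGraph B} (P Q : D.Subgraph) : Prop :=
  (P.verts ∩ Q.verts).Nonempty ∨ ∃ x ∈ P.verts, ∃ y ∈ Q.verts, D.Adj x y

/-- The subgraph of `D` induced by the vertices whose bags contain `v`. -/
def bagSubgraph {V B : Type*} (D : SimpleGraph B) (bag : B → Finset V) (v : V) : D.Subgraph :=
  (⊤ : D.Subgraph).induce {X | v ∈ bag X}

/-- The graph `D`, whose vertices `X` carry bags `bag X` of vertices of `G` (distinct vertices of `D`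
may carry equal bags), is a decomposition of `G`. (`Subgraph.Connected` includes non-emptiness.) -/
structure Decomposition {V B : Type*} (G : SimpleGraph V) (D : SimpleGraph B) where
  /-- The bag at a vertex of `D`. -/
  bag : B → Finset V
  connected : ∀ v, (bagSubgraph D bag v).Connected
  touch : ∀ v w, G.Adj v w → (bagSubgraph D bag v).Touch (bagSubgraph D bag w)

/-- The width of a decomposition: the maximum cardinality of a bag. -/
def Decomposition.width {V B : Type*} [Fintype B] {G : SimpleGraph V} {D : SimpleGraph B}
    (𝒟 : Decomposition G D) : ℕ :=
  Finset.univ.sup fun X => (𝒟.bag X).card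

end SimpleGraph

/-!
The graph drawn is a blow-up of `D`: at each vertex `X` of `D` it has a copy of each element of the
bag of `X`, any two of these copies being adjacent, and along each edge `XY` of `D` it has, for each
pair `(v, w)` of elements of the bags of `X` and `Y`, a strand (a path) from the copy of `v` at `X` to
the copy of `w` at `Y`. The copies of `v`, with the strands from `v` to `v` between them, are connected
as the bags containing `v` are, and together with the inner vertices of the other strands that start
at `v` they are branch sets of a minor `G` (`IsMinor.of_branchSets`, `minorCrossingNumber_le`).

It remains to draw the blow-up so that crossings occur only near the vertices of `D`.

* `D` has a drawing with simple polygonal edges (`IsPlanar.nonempty_polygonalDrawing`). In a small disc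
  around a vertex the edges are replaced by radii; the remaining parts of the curves are disjoint
  compact sets, which have disjoint neighbourhoods. In such a neighbourhood, with the two radii, the
  ends of the edge are joined by a chain of short segments, and a chain with the least number of
  segments does not meet itself (`exists_isSimplePolyline`).
* At each corner of such a polygonal line some vector points to the left of both segments there
  (`exists_cross_pos`). The strands along an edge of `D` are obtained by shifting its corners by
  different small multiples of these vectors, and do not meet except near the ends of the edge.
* Disjointness of segments survives small perturbations (`exists_perturbation_bound`), so all the
  vertices can moreover be put in general position (`exists_near_generalPosition`): the condition is
  that finitely many nonzero polynomials in the coordinates do not vanish. Then the segments form a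
  drawing, in which two edges without a common end meet at most once (`straightDrawing`).

With bags of at most `k` elements, a vertex `X` of `D` has at most `k ^ 2 * (Δ + 1)` edges of the
blow-up next to it. Two crossing edges lie next to a common vertex of `D`, so there are at most
`k ^ 4 * (Δ + 1) ^ 2` crossings for each vertex of `D`.
-/

namespace SimpleGraph

/-! ### Minors from branch sets -/

/-- The subgraph of `H` formed by the edges that have both ends in `U` and in one fibre of `φ`: its
components are the branch sets, if the fibres are connected. -/
def fibreGraph {V W : Type*} (H : SimpleGraph W) (U : Set W) (φ : W → V) : SimpleGraph W where
  Adj x y := H.Adj x y ∧ x ∈ U ∧ y ∈ U ∧ φ x = φ y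
  symm := ⟨fun _ _ h => ⟨h.1.symm, h.2.2.1, h.2.1, h.2.2.2.symm⟩⟩
  loopless := ⟨fun _ h => h.1.ne rfl⟩

/-- `G` is a minor of `H` if the vertices of `G` have disjoint connected branch sets in `H`, those of
adjacent vertices being joined by an edge. The branch sets are the fibres of `φ` over the set `U`. -/
theorem IsMinor.of_branchSets {V W : Type*} {G : SimpleGraph V} {H : SimpleGraph W}
    (U : Set W) (φ : W → V) (hne : ∀ v, ∃ x ∈ U, φ x = v)
    (hconn : ∀ x ∈ U, ∀ y ∈ U, φ x = φ y → (fibreGraph H U φ).Reachable x y)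
    (hadj : ∀ v w, G.Adj v w → ∃ x ∈ U, ∃ y ∈ U, φ x = v ∧ φ y = w ∧ H.Adj x y) :
    G.IsMinor H := by
  let S : H.Subgraph :=
    { verts := U
      Adj := fun x y => H.Adj x y ∧ x ∈ U ∧ y ∈ U ∧ (φ x = φ y ∨ G.Adj (φ x) (φ y))
      adj_sub := fun h => h.1
      edge_vert := fun h => h.2.1
      symm := ⟨fun _ _ h => ⟨h.1.symm, h.2.2.1, h.2.1, h.2.2.2.imp Eq.symm fun h => h.symm⟩⟩ }
  let F : Set (Sym2 S.verts) := {e | (e.map fun x => φ x.1).IsDiag}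
  have hT : ∀ x y : S.verts, (fromEdgeSet (F ∩ S.coe.edgeSet)).Adj x y ↔
      H.Adj x.1 y.1 ∧ φ x.1 = φ y.1 := by
    intro x y
    simp only [fromEdgeSet_adj, Set.mem_inter_iff, mem_edgeSet, Subgraph.coe_adj]
    constructor
    · rintro ⟨⟨h1, h2⟩, -⟩
      exact ⟨h2.1, by simpa [F] using h1⟩
    · rintro ⟨h1, h2⟩
      exact ⟨⟨by simpa [F] using h2, h1, x.2, y.2, Or.inl h2⟩, fun h => h1.ne (congrArg _ h)⟩
  have hreach : ∀ x y : S.verts, φ x.1 = φ y.1 →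
      (fromEdgeSet (F ∩ S.coe.edgeSet)).Reachable x y := by
    intro x y hxy
    obtain ⟨p⟩ := hconn x.1 x.2 y.1 y.2 hxy
    obtain ⟨x, hx⟩ := x
    obtain ⟨y, hy⟩ := y
    simp only at p hxy
    clear hxy
    induction p with
    | nil => rfl
    | cons h p ih =>
      refine Reachable.trans (Adj.reachable ?_) (ih h.2.2.1 hy)
      exact (hT _ _).2 ⟨h.1, h.2.2.2⟩
  have hfib : ∀ x y : S.verts, (fromEdgeSet (F ∩ S.coe.edgeSet)).Reachable x y →
      φ x.1 = φ y.1 := by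
    rintro x y ⟨p⟩
    induction p with
    | nil => rfl
    | cons h p ih => exact ((hT _ _).1 h).2.trans ih
  choose r hrU hr using hne
  have hmk : ∀ x : S.verts, ∀ v, φ x.1 = v →
      (fromEdgeSet (F ∩ S.coe.edgeSet)).connectedComponentMk x =
        (fromEdgeSet (F ∩ S.coe.edgeSet)).connectedComponentMk ⟨r v, hrU v⟩ := by
    intro x v hx
    exact ConnectedComponent.eq.2 (hreach _ _ (hx.trans (hr v).symm))
  have hmk' : ∀ x : S.verts, ∀ v,
      (fromEdgeSet (F ∩ S.coe.edgeSet)).connectedComponentMk x =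
        (fromEdgeSet (F ∩ S.coe.edgeSet)).connectedComponentMk ⟨r v, hrU v⟩ → φ x.1 = v := by
    intro x v hx
    exact (hfib _ _ (ConnectedComponent.eq.1 hx)).trans (hr v)
  let f : V → (fromEdgeSet (F ∩ S.coe.edgeSet)).ConnectedComponent :=
    fun v => (fromEdgeSet (F ∩ S.coe.edgeSet)).connectedComponentMk ⟨r v, hrU v⟩
  have hf : Function.Bijective f := by
    refine ⟨fun v w h => ?_, fun c => ?_⟩
    · exact (hr v).symm.trans (hmk' _ _ h)
    · induction c using ConnectedComponent.ind with
      | h x => exact ⟨φ x.1, (hmk x _ rfl).symm⟩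
  refine ⟨S, F, ⟨⟨Equiv.ofBijective f hf, ?_⟩⟩⟩
  intro v w
  change (f v ≠ f w ∧ ∃ x y, S.coe.Adj x y ∧ _ = f v ∧ _ = f w) ↔ G.Adj v w
  constructor
  · rintro ⟨hvw, x, y, hxy, hx, hy⟩
    have h1 := hmk' _ _ hx
    have h2 := hmk' _ _ hy
    have h3 : φ x.1 = φ y.1 ∨ G.Adj (φ x.1) (φ y.1) := hxy.2.2.2
    rw [h1, h2] at h3
    exact h3.resolve_left fun h => hvw (congrArg f h)
  · intro h
    obtain ⟨x, hx, y, hy, h1, h2, h3⟩ := hadj v w h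
    refine ⟨hf.1.ne h.ne, ⟨x, hx⟩, ⟨y, hy⟩, ⟨h3, hx, hy, Or.inr ?_⟩, hmk _ _ h1, hmk _ _ h2⟩
    rwa [h1, h2]

/-- Transport of a drawing along an isomorphism. -/
def Drawing.copy {V W : Type*} {G : SimpleGraph V} {H : SimpleGraph W} (d : Drawing G)
    (i : H ≃g G) : Drawing H where
  point := d.point ∘ i
  curve e := d.curve (i.mapEdgeSet e)
  point_injective := d.point_injective.comp i.injective
  curve_continuous e := d.curve_continuous _
  curve_injective e := d.curve_injective _
  curve_ends e := by
    rw [d.curve_ends, ← Sym2.map_map]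
    rfl
  vertex_on_curve e v h := by
    have := d.vertex_on_curve _ _ h
    obtain ⟨w, hw, h⟩ := Sym2.mem_map.1 this
    exact i.injective h ▸ hw
  no_three_edges e f g h1 h2 h3 p he hf hg := by
    obtain ⟨v, h4, h5, h6, h7⟩ := d.no_three_edges _ _ _ (i.mapEdgeSet.injective.ne h1)
      (i.mapEdgeSet.injective.ne h2) (i.mapEdgeSet.injective.ne h3) p he hf hg
    obtain ⟨v', h4', rfl⟩ := Sym2.mem_map.1 h4
    obtain ⟨v'', h5', h⟩ := Sym2.mem_map.1 h5
    obtain ⟨v''', h6', h'⟩ := Sym2.mem_map.1 h6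
    exact ⟨v', h4', i.injective h ▸ h5', i.injective h' ▸ h6', h7⟩

theorem Drawing.crossings_copy_subset {V W : Type*} {G : SimpleGraph V} {H : SimpleGraph W}
    (d : Drawing G) (i : H ≃g G) : (d.copy i).crossings ⊆ d.crossings := by
  rintro p ⟨e, f, hef, he, hf, h⟩
  refine ⟨i.mapEdgeSet e, i.mapEdgeSet f, i.mapEdgeSet.injective.ne hef, he, hf, ?_⟩
  rintro ⟨v, h1, h2, h3⟩
  obtain ⟨v', h4, rfl⟩ := Sym2.mem_map.1 h1
  obtain ⟨v'', h5, h6⟩ := Sym2.mem_map.1 h2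
  exact h ⟨v', h4, i.injective h6 ▸ h5, h3⟩

/-- A finite graph with branch sets for `G` bounds the minor crossing number of `G` from above,
whatever its vertex type. -/
theorem minorCrossingNumber_le_of_branchSets {V W : Type*} [Finite W] {G : SimpleGraph V}
    {H : SimpleGraph W} (U : Set W) (φ : W → V) (hne : ∀ v, ∃ x ∈ U, φ x = v)
    (hconn : ∀ x ∈ U, ∀ y ∈ U, φ x = φ y → (fibreGraph H U φ).Reachable x y)
    (hadj : ∀ v w, G.Adj v w → ∃ x ∈ U, ∃ y ∈ U, φ x = v ∧ φ y = w ∧ H.Adj x y) (d : Drawing H) :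
    G.minorCrossingNumber ≤ d.crossings.encard := by
  obtain ⟨n, ⟨ε⟩⟩ := Finite.exists_equiv_fin W
  let H' : SimpleGraph (Fin n) := H.map ε.toEmbedding
  let i : H ≃g H' := Iso.map ε H
  have hmin : G.IsMinor H' := by
    refine IsMinor.of_branchSets (i.symm ⁻¹' U) (φ ∘ i.symm) ?_ ?_ ?_
    · intro v
      obtain ⟨x, hx, h⟩ := hne v
      exact ⟨i x, by simpa using hx, by simpa using h⟩
    · intro x hx y hy hxy
      have h := hconn _ hx _ hy hxy
      let j : fibreGraph H U φ →g fibreGraph H' (i.symm ⁻¹' U) (φ ∘ i.symm) :=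
        ⟨i, by
          intro a b h
          exact ⟨i.map_adj_iff.2 h.1, by simpa using h.2.1, by simpa using h.2.2.1,
            by simpa using h.2.2.2⟩⟩
      have h' := h.map j
      have hj : ∀ z, j (i.symm z) = z := fun z => i.apply_symm_apply z
      rwa [hj, hj] at h'
    · intro v w h
      obtain ⟨x, hx, y, hy, h1, h2, h3⟩ := hadj v w h
      exact ⟨i x, by simpa using hx, i y, by simpa using hy, by simpa using h1, by simpa using h2,
        i.map_adj_iff.2 h3⟩
  calc G.minorCrossingNumber ≤ crossingNumber H' :=
        iInf_le_of_le n (iInf_le_of_le H' (iInf_le_of_le hmin le_rfl))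
    _ ≤ (d.copy i.symm).crossings.encard := iInf_le _ _
    _ ≤ d.crossings.encard := Set.encard_le_encard (d.crossings_copy_subset i.symm)

end SimpleGraph

namespace SimpleGraph

/-! ### Points in general position -/

/-- The determinant of two vectors of the plane. -/
def cross (u v : Plane) : ℝ := u 0 * v 1 - u 1 * v 0

/-- Finitely many nonzero polynomials in the coordinates of a family of points can be made nonzero
simultaneously by an arbitrarily small perturbation of the points. -/
theorem exists_near_eval_ne_zero {W : Type*} [Finite W] (S : Set (MvPolynomial (W × Fin 2) ℝ))
    (hS : S.Finite) (h0 : ∀ Φ ∈ S, Φ ≠ 0) (p : W → Plane) {δ : ℝ} (hδ : 0 < δ) :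
    ∃ q : W → Plane, (∀ x, Dist.dist (q x) (p x) < δ) ∧
      ∀ Φ ∈ S, MvPolynomial.eval (fun c : W × Fin 2 => q c.1 c.2) Φ ≠ 0 := by
  have hprod : ∏ Φ ∈ hS.toFinset, Φ ≠ 0 :=
    Finset.prod_ne_zero_iff.2 fun Φ h => h0 Φ (hS.mem_toFinset.1 h)
  let s : W × Fin 2 → Set ℝ := fun c => Set.Ioo (p c.1 c.2 - δ / 2) (p c.1 c.2 + δ / 2)
  have hinf : ∀ c, (s c).Infinite := fun c => Set.Ioo_infinite (by linarith)
  by_contra! hcon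
  apply hprod
  refine MvPolynomial.funext_set s hinf fun a ha => ?_
  obtain ⟨Φ, hΦ, hz⟩ := hcon (fun x => !₂[a (x, 0), a (x, 1)]) fun x => by
    have h1 := ha (x, 0) (Set.mem_univ _)
    have h2 := ha (x, 1) (Set.mem_univ _)
    simp only [s, Set.mem_Ioo] at h1 h2
    rw [EuclideanSpace.dist_eq, Real.sqrt_lt' hδ]
    simp only [Fin.sum_univ_two, Real.dist_eq, sq_abs]
    simp only [Matrix.cons_val_zero, Matrix.cons_val_one]
    have h3 : (a (x, 0) - p x 0) ^ 2 < (δ / 2) ^ 2 := by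
      apply sq_lt_sq' <;> linarith
    have h4 : (a (x, 1) - p x 1) ^ 2 < (δ / 2) ^ 2 := by
      apply sq_lt_sq' <;> linarith
    nlinarith
  have hcoord : (fun c : W × Fin 2 =>
      (fun x => !₂[a (x, 0), a (x, 1)] : W → Plane) c.1 c.2) = a := by
    funext ⟨x, i⟩
    fin_cases i <;> simp
  rw [hcoord] at hz
  simp only [map_prod, map_zero]
  exact Finset.prod_eq_zero (hS.mem_toFinset.2 hΦ) hz

/-- A family of points in general position: distinct points, no three of them on a line, and no
three segments with six distinct ends through one point. -/
structure GeneralPosition {W : Type*} (p : W → Plane) : Prop where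
  injective : Function.Injective p
  not_collinear : ∀ x y z, x ≠ y → x ≠ z → y ≠ z → cross (p y - p x) (p z - p x) ≠ 0
  not_concurrent : ∀ x : Fin 6 → W, Function.Injective x → ∀ c,
    c ∈ segment ℝ (p (x 0)) (p (x 1)) → c ∈ segment ℝ (p (x 2)) (p (x 3)) →
      c ∉ segment ℝ (p (x 4)) (p (x 5))

theorem cross_eq_zero_of_mem_segment {a b c : Plane} (h : c ∈ segment ℝ a b) :
    cross (b - a) (c - a) = 0 := by
  rw [segment_eq_image'] at h
  obtain ⟨t, -, rfl⟩ := h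
  simp [cross]
  ring

/-- The line through two points, in homogeneous coordinates. -/
def lineCoord {R : Type*} [CommRing R] (a b : Fin 2 → R) : Fin 3 → R :=
  ![a 1 - b 1, b 0 - a 0, a 0 * b 1 - a 1 * b 0]

/-- The determinant that vanishes if three lines, in homogeneous coordinates, are concurrent. -/
def lineDet {R : Type*} [CommRing R] (k l m : Fin 3 → R) : R :=
  k 0 * (l 1 * m 2 - l 2 * m 1) - k 1 * (l 0 * m 2 - l 2 * m 0) + k 2 * (l 0 * m 1 - l 1 * m 0)

theorem lineCoord_of_mem_segment {a b c : Plane} (h : c ∈ segment ℝ a b) :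
    lineCoord a b 0 * c 0 + lineCoord a b 1 * c 1 + lineCoord a b 2 = 0 := by
  have := cross_eq_zero_of_mem_segment h
  simp only [cross, PiLp.sub_apply] at this
  simp only [lineCoord, Matrix.cons_val_zero, Matrix.cons_val_one, Matrix.cons_val]
  linear_combination this

theorem lineDet_eq_zero {a b a' b' a'' b'' c : Plane} (h : c ∈ segment ℝ a b)
    (h' : c ∈ segment ℝ a' b') (h'' : c ∈ segment ℝ a'' b'') :
    lineDet (lineCoord a b) (lineCoord a' b') (lineCoord a'' b'') = 0 := by
  have e := lineCoord_of_mem_segment h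
  have e' := lineCoord_of_mem_segment h'
  have e'' := lineCoord_of_mem_segment h''
  generalize lineCoord (a : Fin 2 → ℝ) b = k at *
  generalize lineCoord (a' : Fin 2 → ℝ) b' = l at *
  generalize lineCoord (a'' : Fin 2 → ℝ) b'' = m at *
  simp only [lineDet]
  linear_combination (l 0 * m 1 - l 1 * m 0) * e - (k 0 * m 1 - k 1 * m 0) * e' +
    (k 0 * l 1 - k 1 * l 0) * e''

theorem exists_near_generalPosition {W : Type*} [Finite W] (p : W → Plane) {δ : ℝ} (hδ : 0 < δ) :
    ∃ q : W → Plane, (∀ x, Dist.dist (q x) (p x) < δ) ∧ GeneralPosition q := by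
  classical
  let Z : W → Fin 2 → MvPolynomial (W × Fin 2) ℝ := fun x i => MvPolynomial.X (x, i)
  let A : W × W → MvPolynomial (W × Fin 2) ℝ := fun x => Z x.1 0 - Z x.2 0
  let C : W × W × W → MvPolynomial (W × Fin 2) ℝ := fun x =>
    (Z x.2.1 0 - Z x.1 0) * (Z x.2.2 1 - Z x.1 1) - (Z x.2.1 1 - Z x.1 1) * (Z x.2.2 0 - Z x.1 0)
  let L : (Fin 6 → W) → MvPolynomial (W × Fin 2) ℝ := fun x =>
    lineDet (lineCoord (Z (x 0)) (Z (x 1))) (lineCoord (Z (x 2)) (Z (x 3)))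
      (lineCoord (Z (x 4)) (Z (x 5)))
  let S := (A '' {x | x.1 ≠ x.2} ∪ C '' {x | x.1 ≠ x.2.1 ∧ x.1 ≠ x.2.2 ∧ x.2.1 ≠ x.2.2}) ∪
    L '' {x | Function.Injective x}
  have hS : S.Finite :=
    (((Set.toFinite _).image _).union ((Set.toFinite _).image _)).union ((Set.toFinite _).image _)
  have h0 : ∀ Φ ∈ S, Φ ≠ 0 := by
    rintro Φ ((⟨⟨x, y⟩, h, rfl⟩ | ⟨⟨x, y, z⟩, ⟨h1, h2, h3⟩, rfl⟩) | ⟨x, h, rfl⟩) hz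
    · have := congrArg (MvPolynomial.eval fun c : W × Fin 2 => if c.1 = x then (1 : ℝ) else 0) hz
      simp only [ne_eq, Set.mem_ofPred_eq] at h
      simp [A, Z, Ne.symm h] at this
    · have := congrArg (MvPolynomial.eval fun c : W × Fin 2 =>
        if c.2 = 0 then (if c.1 = y then (1 : ℝ) else 0) else (if c.1 = z then 1 else 0)) hz
      simp only at h1 h2 h3
      simp [C, Z, h1, h2, h3, Ne.symm h3] at this
    · -- the lines are the two axes and the line through the two unit points
      have := congrArg (MvPolynomial.eval fun c : W × Fin 2 =>
        if c.2 = 0 then (if c.1 = x 1 ∨ c.1 = x 4 then (1 : ℝ) else 0)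
        else (if c.1 = x 3 ∨ c.1 = x 5 then 1 else 0)) hz
      simp [L, Z, lineDet, lineCoord, Function.Injective.eq_iff h] at this
  obtain ⟨q, hq, hq0⟩ := exists_near_eval_ne_zero S hS h0 p hδ
  refine ⟨q, hq, ⟨fun x y hxy => ?_, fun x y z h1 h2 h3 h => ?_, fun x hx c h1 h2 h3 => ?_⟩⟩
  · by_contra hne
    refine hq0 _ (Or.inl (Or.inl ⟨(x, y), hne, rfl⟩)) ?_
    simp [A, Z, hxy]
  · refine hq0 _ (Or.inl (Or.inr ⟨(x, y, z), ⟨h1, h2, h3⟩, rfl⟩)) ?_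
    simpa [C, Z, cross] using h
  · refine hq0 _ (Or.inr ⟨x, hx, rfl⟩) ?_
    simpa [L, Z, lineDet, lineCoord] using lineDet_eq_zero h1 h2 h3

/-! ### Straight-line drawings -/

namespace GeneralPosition

variable {W : Type*} {p : W → Plane}

theorem eq_or_eq_of_mem_segment (hp : GeneralPosition p) {x y z : W} (hxy : x ≠ y)
    (h : p z ∈ segment ℝ (p x) (p y)) : z = x ∨ z = y := by
  by_contra! hz
  exact hp.not_collinear x y z hxy hz.1.symm hz.2.symm (cross_eq_zero_of_mem_segment h)

/-- Two segments with a common end meet only there. -/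
theorem eq_of_mem_segment_of_mem_segment (hp : GeneralPosition p) {x y z : W} (hxy : x ≠ y)
    (hxz : x ≠ z) (hyz : y ≠ z) {c : Plane} (h : c ∈ segment ℝ (p x) (p y))
    (h' : c ∈ segment ℝ (p x) (p z)) : c = p x := by
  have hne := hp.not_collinear x y z hxy hxz hyz
  rw [segment_eq_image'] at h h'
  obtain ⟨s, -, rfl⟩ := h
  obtain ⟨t, -, h⟩ := h'
  have h' : s • (p y - p x) = t • (p z - p x) := (add_left_cancel h).symm
  have h0 : s * (p y - p x) 0 = t * (p z - p x) 0 := by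
    simpa using congrArg (fun v : Plane => v 0) h'
  have h1 : s * (p y - p x) 1 = t * (p z - p x) 1 := by
    simpa using congrArg (fun v : Plane => v 1) h'
  have : s * cross (p y - p x) (p z - p x) = 0 := by
    simp only [cross]
    linear_combination (p z - p x) 1 * h0 - (p z - p x) 0 * h1
  rcases mul_eq_zero.1 this with rfl | h
  · simp
  · exact absurd h hne

/-- Two segments without a common end meet in one point at most. -/
theorem subsingleton_inter (hp : GeneralPosition p) {x y z w : W} (hxz : x ≠ z) (hxw : x ≠ w)
    (hzw : z ≠ w) :
    (segment ℝ (p x) (p y) ∩ segment ℝ (p z) (p w)).Subsingleton := by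
  rintro c ⟨hc, hc'⟩ d ⟨hd, hd'⟩
  have hx := hp.not_collinear z w x hzw hxz.symm hxw.symm
  by_contra hne
  have e := cross_eq_zero_of_mem_segment hc'
  have f := cross_eq_zero_of_mem_segment hd'
  rw [segment_eq_image'] at hc hd
  obtain ⟨s, -, rfl⟩ := hc
  obtain ⟨t, -, rfl⟩ := hd
  have hst : s - t ≠ 0 := fun h => hne (by rw [sub_eq_zero.1 h])
  simp only [cross, PiLp.sub_apply, PiLp.add_apply, PiLp.smul_apply, smul_eq_mul] at e f hx
  refine hx (mul_left_cancel₀ hst ?_)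
  linear_combination s * f - t * e

end GeneralPosition

/-- The ends of an edge, in an arbitrary order. -/
theorem mk_out_edge {W : Type*} {H : SimpleGraph W} (e : H.edgeSet) :
    s(e.1.out.1, e.1.out.2) = e.1 :=
  Quot.out_eq e.1

theorem out_edge_ne {W : Type*} {H : SimpleGraph W} (e : H.edgeSet) : e.1.out.1 ≠ e.1.out.2 := by
  have h := e.2
  rw [← mk_out_edge e] at h
  exact Adj.ne (show H.Adj _ _ from h)

theorem range_lineMap_unitInterval (a b : Plane) :
    Set.range (fun t : unitInterval => AffineMap.lineMap a b (t : ℝ)) = segment ℝ a b := by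
  rw [segment_eq_image_lineMap, Set.image_eq_range]

theorem injective_vec_six {W : Type*} {a b c d e f : W} (hab : a ≠ b) (hcd : c ≠ d) (hef : e ≠ f)
    (hac : a ≠ c) (had : a ≠ d) (hbc : b ≠ c) (hbd : b ≠ d) (hce : c ≠ e) (hcf : c ≠ f)
    (hde : d ≠ e) (hdf : d ≠ f) (hae : a ≠ e) (haf : a ≠ f) (hbe : b ≠ e) (hbf : b ≠ f) :
    Function.Injective ![a, b, c, d, e, f] := by
  rw [← List.nodup_ofFn]
  simp [List.ofFn_succ, *]

/-- Two straight edges with a common end meet only there. -/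
theorem GeneralPosition.eq_of_mem_edges {W : Type*} {H : SimpleGraph W} {p : W → Plane}
    (hp : GeneralPosition p) {e f : H.edgeSet} (hef : e ≠ f) {v : W} (hve : v ∈ e.1)
    (hvf : v ∈ f.1) {c : Plane} (he : c ∈ segment ℝ (p e.1.out.1) (p e.1.out.2))
    (hf : c ∈ segment ℝ (p f.1.out.1) (p f.1.out.2)) : c = p v := by
  have hef' : e.1 ≠ f.1 := fun h => hef (Subtype.ext h)
  rw [← mk_out_edge e, ← mk_out_edge f] at hef'
  have h1 := out_edge_ne e
  have h2 := out_edge_ne f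
  rw [← mk_out_edge e, Sym2.mem_iff] at hve
  rw [← mk_out_edge f, Sym2.mem_iff] at hvf
  generalize e.1.out.1 = a at *
  generalize e.1.out.2 = b at *
  generalize f.1.out.1 = a' at *
  generalize f.1.out.2 = b' at *
  rcases hve with rfl | rfl <;> rcases hvf with rfl | rfl
  · exact hp.eq_of_mem_segment_of_mem_segment h1 h2 (by grind) he hf
  · rw [segment_symm] at hf
    exact hp.eq_of_mem_segment_of_mem_segment h1 h2.symm (by grind) he hf
  · rw [segment_symm] at he
    exact hp.eq_of_mem_segment_of_mem_segment h1.symm h2 (by grind) he hf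
  · rw [segment_symm] at he hf
    exact hp.eq_of_mem_segment_of_mem_segment h1.symm h2.symm (by grind) he hf

/-- Points in general position carry a straight-line drawing of every graph. -/
noncomputable def straightDrawing {W : Type*} (H : SimpleGraph W) {p : W → Plane}
    (hp : GeneralPosition p) : Drawing H where
  point := p
  curve e t := AffineMap.lineMap (p e.1.out.1) (p e.1.out.2) (t : ℝ)
  point_injective := hp.injective
  curve_continuous e := by fun_prop
  curve_injective e :=
    (AffineMap.lineMap_injective ℝ (hp.injective.ne (out_edge_ne e))).comp Subtype.val_injective
  curve_ends e := by
    conv_rhs => rw [← mk_out_edge e]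
    simp
  vertex_on_curve e v h := by
    rw [range_lineMap_unitInterval] at h
    rw [← mk_out_edge e, Sym2.mem_iff]
    exact hp.eq_or_eq_of_mem_segment (out_edge_ne e) h
  no_three_edges := by
    have mem : ∀ (g : H.edgeSet) v, p v ∈ segment ℝ (p g.1.out.1) (p g.1.out.2) → v ∈ g.1 := by
      intro g v h
      rw [← mk_out_edge g, Sym2.mem_iff]
      exact hp.eq_or_eq_of_mem_segment (out_edge_ne g) h
    intro e f g hef hfg heg c he hf hg
    rw [range_lineMap_unitInterval] at he hf hg
    by_cases h1 : ∃ v, v ∈ e.1 ∧ v ∈ f.1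
    · obtain ⟨v, hve, hvf⟩ := h1
      obtain rfl := hp.eq_of_mem_edges hef hve hvf he hf
      exact ⟨v, hve, hvf, mem g v hg, rfl⟩
    by_cases h2 : ∃ v, v ∈ f.1 ∧ v ∈ g.1
    · obtain ⟨v, hvf, hvg⟩ := h2
      obtain rfl := hp.eq_of_mem_edges hfg hvf hvg hf hg
      exact ⟨v, mem e v he, hvf, hvg, rfl⟩
    by_cases h3 : ∃ v, v ∈ e.1 ∧ v ∈ g.1
    · obtain ⟨v, hve, hvg⟩ := h3
      obtain rfl := hp.eq_of_mem_edges heg hve hvg he hg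
      exact ⟨v, hve, mem f v hf, hvg, rfl⟩
    exfalso
    have hinj : Function.Injective
        ![e.1.out.1, e.1.out.2, f.1.out.1, f.1.out.2, g.1.out.1, g.1.out.2] := by
      have e1 := out_edge_ne e
      have e2 := out_edge_ne f
      have e3 := out_edge_ne g
      rw [← mk_out_edge e, ← mk_out_edge f] at h1
      rw [← mk_out_edge f, ← mk_out_edge g] at h2
      rw [← mk_out_edge e, ← mk_out_edge g] at h3
      simp only [Sym2.mem_iff, not_exists, not_and, not_or] at h1 h2 h3
      have a1 := h1 _ (Or.inl rfl)
      have a2 := h1 _ (Or.inr rfl)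
      have b1 := h2 _ (Or.inl rfl)
      have b2 := h2 _ (Or.inr rfl)
      have c1 := h3 _ (Or.inl rfl)
      have c2 := h3 _ (Or.inr rfl)
      exact injective_vec_six e1 e2 e3 a1.1 a1.2 a2.1 a2.2 b1.1 b1.2 b2.1 b2.2 c1.1 c1.2 c2.1 c2.2
    exact hp.not_concurrent _ hinj c he hf hg

theorem range_curve_straightDrawing {W : Type*} {H : SimpleGraph W} {p : W → Plane}
    (hp : GeneralPosition p) {e : H.edgeSet} {x y : W} (h : e.1 = s(x, y)) :
    Set.range ((straightDrawing H hp).curve e) = segment ℝ (p x) (p y) := by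
  have h1 := range_lineMap_unitInterval (p e.1.out.1) (p e.1.out.2)
  refine h1.trans ?_
  rw [← mk_out_edge e, Sym2.eq_iff] at h
  rcases h with ⟨h2, h3⟩ | ⟨h2, h3⟩
  · rw [h2, h3]
  · rw [h2, h3, segment_symm]

/-- A crossing of a straight-line drawing lies on two edges without a common end. -/
theorem exists_edges_of_mem_crossings {W : Type*} {H : SimpleGraph W} {p : W → Plane}
    (hp : GeneralPosition p) {c : Plane} (hc : c ∈ (straightDrawing H hp).crossings) :
    ∃ e f : H.edgeSet, c ∈ Set.range ((straightDrawing H hp).curve e) ∧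
      c ∈ Set.range ((straightDrawing H hp).curve f) ∧ ∀ v ∈ e.1, v ∉ f.1 := by
  obtain ⟨e, f, hef, he, hf, hv⟩ := hc
  refine ⟨e, f, he, hf, fun v hve hvf => hv ⟨v, hve, hvf, ?_⟩⟩
  rw [range_curve_straightDrawing hp (mk_out_edge _).symm] at he hf
  exact hp.eq_of_mem_edges hef hve hvf he hf

end SimpleGraph

namespace SimpleGraph

/-! ### Simple polygonal lines -/

/-- The points `b 0, …, b m` are the corners of a simple polygonal line. -/
structure IsSimplePolyline (m : ℕ) (b : ℕ → Plane) : Prop where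
  disjoint : ∀ i j, i + 2 ≤ j → j < m →
    Disjoint (segment ℝ (b i) (b (i + 1))) (segment ℝ (b j) (b (j + 1)))
  notMem_left : ∀ i, i + 2 ≤ m → b (i + 2) ∉ segment ℝ (b i) (b (i + 1))
  notMem_right : ∀ i, i + 2 ≤ m → b i ∉ segment ℝ (b (i + 1)) (b (i + 2))

/-- Points of the plane are adjacent if a segment in `Q` of length less than `η` joins them. -/
def hopGraph (Q : Set Plane) (η : ℝ) : SimpleGraph Plane where
  Adj x y := x ≠ y ∧ segment ℝ x y ⊆ Q ∧ Dist.dist x y < η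
  symm := ⟨fun x y h => ⟨h.1.symm, by rw [segment_symm]; exact h.2.1, by
    rw [_root_.dist_comm]; exact h.2.2⟩⟩
  loopless := ⟨fun _ h => h.1 rfl⟩

theorem exists_walk_hopGraph {Q : Set Plane} {η : ℝ} {x y : Plane} (h : segment ℝ x y ⊆ Q)
    (h' : Dist.dist x y < η) : ∃ p : (hopGraph Q η).Walk x y, p.length ≤ 1 := by
  by_cases hxy : x = y
  · subst hxy
    exact ⟨.nil, by simp⟩
  · exact ⟨Walk.cons (show (hopGraph Q η).Adj x y from ⟨hxy, h, h'⟩) .nil, by simp⟩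

theorem Walk.le_length_of_length_eq_dist {W : Type*} {H : SimpleGraph W} {u v : W} {p : H.Walk u v}
    (hp : p.length = H.dist u v) {i j : ℕ} (hj : j ≤ p.length)
    (q : H.Walk (p.getVert i) (p.getVert j)) : j ≤ i + q.length := by
  have h := dist_le (((p.take i).append q).append (p.drop j))
  rw [← hp] at h
  simp only [Walk.length_append, Walk.take_length, Walk.drop_length] at h
  omega

/-- A polygonal line with the least number of hops is simple: otherwise a point where it meets
itself would give a shortcut. -/
theorem exists_isSimplePolyline {Q : Set Plane} {η : ℝ} {A C : Plane}
    (hr : (hopGraph Q η).Reachable A C) (h0 : 0 < η) (hη : η ≤ Dist.dist A C) :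
    ∃ (m : ℕ) (b : ℕ → Plane), 2 ≤ m ∧ b 0 = A ∧ b m = C ∧
      (∀ i < m, segment ℝ (b i) (b (i + 1)) ⊆ Q) ∧ IsSimplePolyline m b := by
  obtain ⟨p, hp⟩ := hr.exists_walk_length_eq_dist
  have hadj : ∀ i < p.length, (hopGraph Q η).Adj (p.getVert i) (p.getVert (i + 1)) :=
    fun i hi => p.adj_getVert_succ hi
  have hball : ∀ i < p.length, segment ℝ (p.getVert i) (p.getVert (i + 1)) ⊆
      Metric.ball (p.getVert i) η := fun i hi =>
    (convex_ball _ _).segment_subset (Metric.mem_ball_self h0)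
      (Metric.mem_ball'.2 (hadj i hi).2.2)
  have hball' : ∀ i < p.length, segment ℝ (p.getVert i) (p.getVert (i + 1)) ⊆
      Metric.ball (p.getVert (i + 1)) η := fun i hi =>
    (convex_ball _ _).segment_subset (Metric.mem_ball.2 (hadj i hi).2.2)
      (Metric.mem_ball_self h0)
  have hleft : ∀ i < p.length, ∀ z ∈ segment ℝ (p.getVert i) (p.getVert (i + 1)),
      ∃ q : (hopGraph Q η).Walk (p.getVert i) z, q.length ≤ 1 := fun i hi z hz =>
    exists_walk_hopGraph (((convex_segment _ _).segment_subset (left_mem_segment _ _ _) hz).trans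
      (hadj i hi).2.1) (Metric.mem_ball'.1 (hball i hi hz))
  have hright : ∀ i < p.length, ∀ z ∈ segment ℝ (p.getVert i) (p.getVert (i + 1)),
      ∃ q : (hopGraph Q η).Walk z (p.getVert (i + 1)), q.length ≤ 1 := fun i hi z hz =>
    exists_walk_hopGraph (((convex_segment _ _).segment_subset hz (right_mem_segment _ _ _)).trans
      (hadj i hi).2.1) (Metric.mem_ball.1 (hball' i hi hz))
  refine ⟨p.length, p.getVert, ?_, p.getVert_zero, p.getVert_length,
    fun i hi => (hadj i hi).2.1, ⟨fun i j hij hj => ?_, fun i hi hmem => ?_, fun i hi hmem => ?_⟩⟩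
  · by_contra! hlt
    rcases Nat.lt_succ_iff.1 hlt |>.lt_or_eq with h | h
    · have := Walk.eq_of_length_eq_zero (p := p) (by omega)
      rw [this, _root_.dist_self] at hη
      linarith
    · exact absurd (p.adj_of_length_eq_one h).2.2 hη.not_gt
  · rw [Set.disjoint_left]
    intro z hz hz'
    obtain ⟨q, hq⟩ := hleft i (by omega) z hz
    obtain ⟨q', hq'⟩ := hright j hj z hz'
    have := Walk.le_length_of_length_eq_dist hp (i := i) (j := j + 1) (by omega)
      (q.append q')
    rw [Walk.length_append] at this
    omega
  · obtain ⟨q, hq⟩ := hleft i (by omega) _ hmem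
    have := Walk.le_length_of_length_eq_dist hp (i := i) (j := i + 2) (by omega) q
    omega
  · obtain ⟨q, hq⟩ := hright (i + 1) (by omega) _ hmem
    have := Walk.le_length_of_length_eq_dist hp (i := i) (j := i + 2) (by omega) q
    omega

/-- A connected set near each of whose points the set `Q` is convex enough can be traversed by
hops. -/
theorem reachable_hopGraph {Q K : Set Plane} {η : ℝ} (h0 : 0 < η) (hK : IsPreconnected K)
    (h : ∀ x ∈ K, ∀ᶠ y in nhdsWithin x K, segment ℝ x y ⊆ Q) {x y : Plane} (hx : x ∈ K)
    (hy : y ∈ K) : (hopGraph Q η).Reachable x y := by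
  refine hK.induction₂ (fun x y => (hopGraph Q η).Reachable x y) (fun x hx => ?_) (fun _ _ _ _ _ _ => Reachable.trans)
    (fun _ _ _ _ => Reachable.symm) hx hy
  filter_upwards [h x hx, nhdsWithin_le_nhds (Metric.ball_mem_nhds x h0)] with y h1 h2
  obtain ⟨p, -⟩ := exists_walk_hopGraph h1 (Metric.mem_ball'.1 h2)
  exact p.reachable

/-! ### Polygonal drawings of planar graphs -/

theorem isCompact_segment (a b : Plane) : IsCompact (segment ℝ a b) := by
  rw [segment_eq_image_lineMap]
  exact isCompact_Icc.image (by fun_prop)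

/-- The last exit of a curve from a disc around its start, and the first entry after that into a disc
around its end. -/
theorem exists_exit_times {γ : ℝ → Plane} (hγ : Continuous γ) {r : ℝ} (hr : 0 < r)
    (h : 2 * r < Dist.dist (γ 0) (γ 1)) :
    ∃ s t, 0 ≤ s ∧ s ≤ t ∧ t ≤ 1 ∧ Dist.dist (γ s) (γ 0) = r ∧ Dist.dist (γ t) (γ 1) = r ∧
      ∀ u ∈ Set.Icc s t, r ≤ Dist.dist (γ u) (γ 0) ∧ r ≤ Dist.dist (γ u) (γ 1) := by
  have hc0 : Continuous fun u => Dist.dist (γ u) (γ 0) := by fun_prop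
  have hc1 : Continuous fun u => Dist.dist (γ u) (γ 1) := by fun_prop
  have hd0 : r ≤ Dist.dist (γ 1) (γ 0) := by rw [_root_.dist_comm]; linarith
  obtain ⟨s, ⟨⟨hs0, hs1⟩, hs⟩, hsmax⟩ :=
    (isCompact_Icc.inter_right (isClosed_Iic.preimage hc0) :
      IsCompact (Set.Icc (0 : ℝ) 1 ∩ (fun u => Dist.dist (γ u) (γ 0)) ⁻¹' Set.Iic r)).exists_isGreatest
      ⟨0, by simp [hr.le]⟩
  simp only [Set.mem_preimage, Set.mem_Iic] at hs
  have hs' : Dist.dist (γ s) (γ 0) = r := by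
    obtain ⟨u, ⟨hu, hu1⟩, hur⟩ := intermediate_value_Icc hs1 hc0.continuousOn ⟨hs, hd0⟩
    have : u ≤ s := hsmax ⟨⟨hs0.trans hu, hu1⟩, hur.le⟩
    rwa [le_antisymm this hu] at hur
  have hds : r ≤ Dist.dist (γ s) (γ 1) := by
    have := _root_.dist_triangle_left (γ 0) (γ 1) (γ s)
    linarith
  obtain ⟨t, ⟨⟨ht0, ht1⟩, ht⟩, htmin⟩ :=
    (isCompact_Icc.inter_right (isClosed_Iic.preimage hc1) :
      IsCompact (Set.Icc s 1 ∩ (fun u => Dist.dist (γ u) (γ 1)) ⁻¹' Set.Iic r)).exists_isLeast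
      ⟨1, by simp [hr.le, hs1]⟩
  simp only [Set.mem_preimage, Set.mem_Iic] at ht
  have ht' : Dist.dist (γ t) (γ 1) = r := by
    obtain ⟨u, ⟨hu, hu1⟩, hur⟩ := intermediate_value_Icc' ht0 hc1.continuousOn ⟨ht, hds⟩
    have : t ≤ u := htmin ⟨⟨hu, hu1.trans ht1⟩, hur.le⟩
    rwa [le_antisymm hu1 this] at hur
  refine ⟨s, t, hs0, ht0, ht1, hs', ht', fun u hu => ⟨?_, ?_⟩⟩
  · by_contra! hlt
    have : u ≤ s := hsmax ⟨⟨hs0.trans hu.1, hu.2.trans ht1⟩, hlt.le⟩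
    rw [le_antisymm this hu.1] at hlt
    linarith
  · by_contra! hlt
    have : t ≤ u := htmin ⟨⟨hu.1, hu.2.trans ht1⟩, hlt.le⟩
    rw [le_antisymm hu.2 this] at hlt
    linarith

theorem segment_subset_closedBall {c a : Plane} {r : ℝ} (h : Dist.dist a c = r) :
    segment ℝ c a ⊆ Metric.closedBall c r :=
  (convex_closedBall _ _).segment_subset
    (Metric.mem_closedBall_self (h ▸ dist_nonneg)) (Metric.mem_closedBall.2 h.le)

/-- A radius of a circle meets the circle only in its end. -/
theorem eq_of_mem_segment_of_le_dist {c a z : Plane} {r : ℝ} (h : Dist.dist a c = r)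
    (hz : z ∈ segment ℝ c a) (hr : r ≤ Dist.dist z c) : z = a := by
  rw [segment_eq_image'] at hz
  obtain ⟨t, ⟨ht0, ht1⟩, rfl⟩ := hz
  rw [dist_eq_norm] at h hr
  simp only [add_sub_cancel_left, norm_smul, Real.norm_eq_abs, abs_of_nonneg ht0, h] at hr
  rcases (norm_nonneg (a - c)).eq_or_lt with h0 | h0
  · have : a - c = 0 := norm_eq_zero.1 h0.symm
    simp [sub_eq_zero.1 this]
  · have : t = 1 := by nlinarith
    simp [this]

/-- Two different radii of a circle meet only in its centre. -/
theorem eq_centre_of_mem_segments {c a a' z : Plane} {r : ℝ} (h0 : 0 < r) (h : Dist.dist a c = r)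
    (h' : Dist.dist a' c = r) (hne : a ≠ a') (hz : z ∈ segment ℝ c a) (hz' : z ∈ segment ℝ c a') :
    z = c := by
  rw [segment_eq_image'] at hz hz'
  obtain ⟨s, ⟨hs0, hs1⟩, rfl⟩ := hz
  obtain ⟨t, ⟨ht0, ht1⟩, hst⟩ := hz'
  have hst : t • (a' - c) = s • (a - c) := add_left_cancel hst
  rw [dist_eq_norm] at h h'
  have hn := congrArg norm hst
  rw [norm_smul, norm_smul, h, h', Real.norm_eq_abs, Real.norm_eq_abs, abs_of_nonneg hs0,
    abs_of_nonneg ht0] at hn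
  obtain rfl := mul_right_cancel₀ h0.ne' hn
  rcases hs0.eq_or_lt with rfl | hpos
  · simp
  · exact absurd (sub_left_injective (smul_right_injective _ hpos.ne' hst)).symm hne

end SimpleGraph

namespace SimpleGraph
open Filter Topology

/-- A crossing-free drawing in which the edges are simple polygonal lines of at least two
segments. -/
structure PolygonalDrawing {B : Type*} (D : SimpleGraph B) where
  /-- The point that represents a vertex. -/
  point : B → Plane
  /-- The vertex at which the polygonal line of an edge starts. -/
  src : D.edgeSet → B
  /-- The vertex at which the polygonal line of an edge ends. -/
  tgt : D.edgeSet → B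
  /-- The number of segments of an edge. -/
  len : D.edgeSet → ℕ
  /-- The corners of the polygonal line of an edge, including its ends. -/
  corner : D.edgeSet → ℕ → Plane
  point_injective : Function.Injective point
  mk_src_tgt : ∀ e, s(src e, tgt e) = e.1
  two_le_len : ∀ e, 2 ≤ len e
  corner_zero : ∀ e, corner e 0 = point (src e)
  corner_len : ∀ e, corner e (len e) = point (tgt e)
  simple : ∀ e, IsSimplePolyline (len e) (corner e)
  eq_end_of_mem : ∀ e X, ∀ i < len e, point X ∈ segment ℝ (corner e i) (corner e (i + 1)) →
    X = src e ∨ X = tgt e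
  mem_range_of_mem : ∀ e f, e ≠ f → ∀ i < len e, ∀ j < len f, ∀ z,
    z ∈ segment ℝ (corner e i) (corner e (i + 1)) →
      z ∈ segment ℝ (corner f j) (corner f (j + 1)) → z ∈ Set.range point

theorem eventually_disjoint_thickening {S T : Set Plane} (h : Disjoint S T) (hS : IsCompact S)
    (hT : IsClosed T) :
    ∀ᶠ ε in 𝓝[>] (0 : ℝ), Disjoint (Metric.thickening ε S) (Metric.thickening ε T) := by
  obtain ⟨δ, hδ, hdis⟩ := h.exists_thickenings hS hT
  filter_upwards [Ioo_mem_nhdsGT hδ] with ε hε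
  exact hdis.mono (Metric.thickening_mono hε.2.le _) (Metric.thickening_mono hε.2.le _)

/-- In a disc around each vertex the edges become radii; outside these discs they are disjoint
compact sets, and have disjoint neighbourhoods, in which they become polygonal. -/
theorem IsPlanar.nonempty_polygonalDrawing {B : Type*} [Finite B] {D : SimpleGraph B}
    (h : D.IsPlanar) : Nonempty (PolygonalDrawing D) := by
  obtain ⟨d, hd⟩ := h
  have hends : ∀ e : D.edgeSet, ∃ x y, s(x, y) = e.1 ∧ d.curve e 0 = d.point x ∧
      d.curve e 1 = d.point y := by
    rintro ⟨e, he⟩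
    have h := d.curve_ends ⟨e, he⟩
    induction e using Sym2.ind with
    | h x y =>
      rw [Sym2.map_mk, Sym2.eq_iff] at h
      rcases h with ⟨h1, h2⟩ | ⟨h1, h2⟩
      · exact ⟨x, y, rfl, h1, h2⟩
      · exact ⟨y, x, Sym2.eq_swap, h1, h2⟩
  choose src tgt hmk hsrc htgt using hends
  have hst : ∀ e, src e ≠ tgt e := fun e => by
    have h := e.2
    rw [← hmk e] at h
    exact Adj.ne (show D.Adj _ _ from h)
  obtain ⟨r, hr0, hrd, hrc⟩ : ∃ r : ℝ, 0 < r ∧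
      (∀ X Z, X ≠ Z → 2 * r < Dist.dist (d.point X) (d.point Z)) ∧
      ∀ e X, X ∉ e.1 → ∀ z ∈ Set.range (d.curve e), r ≤ Dist.dist z (d.point X) := by
    have h1 : ∀ᶠ r in 𝓝[>] (0 : ℝ), ∀ X Z, X ≠ Z → 2 * r < Dist.dist (d.point X) (d.point Z) := by
      refine eventually_all.2 fun X => eventually_all.2 fun Z => ?_
      by_cases hXZ : X = Z
      · simp [hXZ]
      · have hpos := dist_pos.2 (d.point_injective.ne hXZ)
        filter_upwards [Ioo_mem_nhdsGT (half_pos hpos)] with r hr _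
        linarith [hr.2]
    have h2 : ∀ᶠ r in 𝓝[>] (0 : ℝ), ∀ e X, X ∉ e.1 →
        ∀ z ∈ Set.range (d.curve e), r ≤ Dist.dist z (d.point X) := by
      refine eventually_all.2 fun e => eventually_all.2 fun X => ?_
      by_cases hX : X ∈ e.1
      · simp [hX]
      · have hcl : IsClosed (Set.range (d.curve e)) :=
          (isCompact_range (d.curve_continuous e)).isClosed
        have hn : d.point X ∉ Set.range (d.curve e) := fun h => hX (d.vertex_on_curve e X h)
        obtain ⟨δ, hδ, hball⟩ := Metric.isOpen_iff.1 hcl.isOpen_compl _ hn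
        filter_upwards [Ioo_mem_nhdsGT hδ] with r hr _ z hz
        by_contra! hlt
        exact hball (Metric.mem_ball.2 (hlt.trans hr.2)) hz
    obtain ⟨r, ⟨h1, h2⟩, hr⟩ := ((h1.and h2).and self_mem_nhdsWithin).exists
    exact ⟨r, hr, h1, h2⟩
  let γ : D.edgeSet → ℝ → Plane := fun e => Set.IccExtend zero_le_one (d.curve e)
  have hγ : ∀ e, Continuous (γ e) := fun e => (d.curve_continuous e).Icc_extend'
  have hγr : ∀ e u, γ e u ∈ Set.range (d.curve e) := fun e u => ⟨_, rfl⟩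
  have hγ0 : ∀ e, γ e 0 = d.point (src e) := fun e =>
    (Set.IccExtend_left zero_le_one (d.curve e)).trans (hsrc e)
  have hγ1 : ∀ e, γ e 1 = d.point (tgt e) := fun e =>
    (Set.IccExtend_right zero_le_one (d.curve e)).trans (htgt e)
  have hex := fun e => exists_exit_times (hγ e) hr0
    (by rw [hγ0, hγ1]; exact hrd _ _ (hst e))
  simp only [hγ0, hγ1] at hex
  choose s t hs0 hst' ht1 hs ht hmid using hex
  let M : D.edgeSet → Set Plane := fun e => γ e '' Set.Icc (s e) (t e)
  have haM : ∀ e, γ e (s e) ∈ M e := fun e => ⟨s e, ⟨le_rfl, hst' e⟩, rfl⟩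
  have hcM : ∀ e, γ e (t e) ∈ M e := fun e => ⟨t e, ⟨hst' e, le_rfl⟩, rfl⟩
  have hMc : ∀ e, IsCompact (M e) := fun e => isCompact_Icc.image (hγ e)
  have hMd : ∀ e X, ∀ z ∈ M e, r ≤ Dist.dist z (d.point X) := by
    rintro e X z ⟨u, hu, rfl⟩
    by_cases hX : X ∈ e.1
    · rw [← hmk e, Sym2.mem_iff] at hX
      rcases hX with rfl | rfl
      · exact (hmid e u hu).1
      · exact (hmid e u hu).2
    · exact hrc e X hX _ (hγr e u)
  have hMM : ∀ e f, e ≠ f → Disjoint (M e) (M f) := by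
    intro e f hef
    rw [Set.disjoint_left]
    intro z hz hz'
    have hze : z ∈ Set.range (d.curve e) := by
      obtain ⟨u, -, rfl⟩ := hz
      exact hγr e u
    have hzf : z ∈ Set.range (d.curve f) := by
      obtain ⟨u, -, rfl⟩ := hz'
      exact hγr f u
    have hnc : z ∉ d.crossings := by simp [hd]
    by_cases hv : ∃ v, v ∈ e.1 ∧ v ∈ f.1 ∧ z = d.point v
    · obtain ⟨v, -, -, rfl⟩ := hv
      have := hMd e v _ hz
      rw [_root_.dist_self] at this
      linarith
    · exact hnc ⟨e, f, hef, hze, hzf, hv⟩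
  let R : D.edgeSet → Set Plane := fun e =>
    segment ℝ (d.point (src e)) (γ e (s e)) ∪ segment ℝ (d.point (tgt e)) (γ e (t e))
  have hMR : ∀ e f, e ≠ f → Disjoint (M e) (R f) := by
    intro e f hef
    rw [Set.disjoint_left]
    rintro z hz (hz' | hz')
    · rw [eq_of_mem_segment_of_le_dist (hs f) hz' (hMd e _ z hz)] at hz
      exact Set.disjoint_left.1 (hMM e f hef) hz (haM f)
    · rw [eq_of_mem_segment_of_le_dist (ht f) hz' (hMd e _ z hz)] at hz
      exact Set.disjoint_left.1 (hMM e f hef) hz (hcM f)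
  have hRR : ∀ e f, e ≠ f → ∀ z, z ∈ R e → z ∈ R f → z ∈ Set.range d.point := by
    have key : ∀ e f, e ≠ f → ∀ z X X' a a', a ∈ M e → a' ∈ M f → Dist.dist a (d.point X) = r →
        Dist.dist a' (d.point X') = r → z ∈ segment ℝ (d.point X) a →
          z ∈ segment ℝ (d.point X') a' → z ∈ Set.range d.point := by
      intro e f hef z X X' a a' ha ha' hd hd' hz hz'
      by_cases hX : X = X'
      · subst hX
        refine ⟨X, (eq_centre_of_mem_segments hr0 hd hd' ?_ hz hz').symm⟩
        rintro rfl
        exact Set.disjoint_left.1 (hMM e f hef) ha ha'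
      · have h1 := segment_subset_closedBall hd hz
        have h2 := segment_subset_closedBall hd' hz'
        rw [Metric.mem_closedBall] at h1 h2
        have := _root_.dist_triangle_left (d.point X) (d.point X') z
        linarith [hrd X X' hX]
    rintro e f hef z (hz | hz) (hz' | hz')
    · exact key e f hef z _ _ _ _ (haM e) (haM f) (hs e) (hs f) hz hz'
    · exact key e f hef z _ _ _ _ (haM e) (hcM f) (hs e) (ht f) hz hz'
    · exact key e f hef z _ _ _ _ (hcM e) (haM f) (ht e) (hs f) hz hz'
    · exact key e f hef z _ _ _ _ (hcM e) (hcM f) (ht e) (ht f) hz hz'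
  have hRc : ∀ e, IsCompact (R e) := fun e =>
    (isCompact_segment _ _).union (isCompact_segment _ _)
  obtain ⟨ε, hε0, hεM, hεP⟩ : ∃ ε : ℝ, 0 < ε ∧
      (∀ e f, e ≠ f → Disjoint (Metric.thickening ε (M e)) (Metric.thickening ε (M f ∪ R f))) ∧
      ∀ e X, d.point X ∉ Metric.thickening ε (M e) := by
    have h1 : ∀ᶠ ε in 𝓝[>] (0 : ℝ), ∀ e f, e ≠ f →
        Disjoint (Metric.thickening ε (M e)) (Metric.thickening ε (M f ∪ R f)) := by
      refine eventually_all.2 fun e => eventually_all.2 fun f => ?_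
      by_cases hef : e = f
      · simp [hef]
      · filter_upwards [eventually_disjoint_thickening
          (Disjoint.union_right (hMM e f hef) (hMR e f hef)) (hMc e)
          ((hMc f).union (hRc f)).isClosed] with ε hε _ using hε
    have h2 : ∀ᶠ ε in 𝓝[>] (0 : ℝ), ∀ e X,
        Disjoint (Metric.thickening ε (M e)) (Metric.thickening ε {d.point X}) := by
      refine eventually_all.2 fun e => eventually_all.2 fun X => ?_
      refine eventually_disjoint_thickening ?_ (hMc e) isClosed_singleton
      rw [Set.disjoint_singleton_right]
      intro hX
      have := hMd e X _ hX
      rw [_root_.dist_self] at this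
      linarith
    obtain ⟨ε, ⟨h1, h2⟩, hε⟩ := ((h1.and h2).and self_mem_nhdsWithin).exists
    exact ⟨ε, hε, h1, fun e X hX => Set.disjoint_left.1 (h2 e X) hX
      (Metric.self_subset_thickening hε _ rfl)⟩
  let Q : D.edgeSet → Set Plane := fun e => Metric.thickening ε (M e) ∪ R e
  have hQQ : ∀ e f, e ≠ f → ∀ z, z ∈ Q e → z ∈ Q f → z ∈ Set.range d.point := by
    rintro e f hef z (hz | hz) (hz' | hz')
    · exact (Set.disjoint_left.1 (hεM e f hef) hz
        (Metric.thickening_subset_of_subset ε Set.subset_union_left hz')).elim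
    · exact (Set.disjoint_left.1 (hεM e f hef) hz
        (Metric.self_subset_thickening hε0 _ (Or.inr hz'))).elim
    · exact (Set.disjoint_left.1 (hεM f e hef.symm) hz'
        (Metric.self_subset_thickening hε0 _ (Or.inr hz))).elim
    · exact hRR e f hef z hz hz'
  have hPQ : ∀ e X, d.point X ∈ Q e → X = src e ∨ X = tgt e := by
    have key : ∀ X Z a, Dist.dist a (d.point Z) = r → d.point X ∈ segment ℝ (d.point Z) a →
        X = Z := by
      intro X Z a ha hX
      by_contra hne
      have h1 := Metric.mem_closedBall.1 (segment_subset_closedBall ha hX)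
      linarith [hrd X Z hne]
    rintro e X (hX | hX | hX)
    · exact absurd hX (hεP e X)
    · exact Or.inl (key _ _ _ (hs e) hX)
    · exact Or.inr (key _ _ _ (ht e) hX)
  have hη : ∀ e, 0 < Dist.dist (d.point (src e)) (d.point (tgt e)) := fun e =>
    dist_pos.2 (d.point_injective.ne (hst e))
  have hreach : ∀ e, (hopGraph (Q e) (Dist.dist (d.point (src e)) (d.point (tgt e)))).Reachable
      (d.point (src e)) (d.point (tgt e)) := by
    intro e
    have hseg : ∀ a b : Plane, segment ℝ a b ⊆ Q e →
        (hopGraph (Q e) (Dist.dist (d.point (src e)) (d.point (tgt e)))).Reachable a b := by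
      intro a b hab
      refine reachable_hopGraph (hη e) (convex_segment a b).isPreconnected (fun x hx => ?_)
        (left_mem_segment _ _ _) (right_mem_segment _ _ _)
      filter_upwards [self_mem_nhdsWithin] with y hy
      exact ((convex_segment a b).segment_subset hx hy).trans hab
    have hmiddle : (hopGraph (Q e) (Dist.dist (d.point (src e)) (d.point (tgt e)))).Reachable
        (γ e (s e)) (γ e (t e)) := by
      refine reachable_hopGraph (hη e) (isPreconnected_Icc.image _ (hγ e).continuousOn)
        (fun x hx => ?_) (haM e) (hcM e)
      filter_upwards [nhdsWithin_le_nhds (Metric.ball_mem_nhds x hε0)] with y hy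
      refine ((convex_ball x ε).segment_subset (Metric.mem_ball_self hε0) hy).trans fun z hz => ?_
      exact Or.inl (Metric.mem_thickening_iff.2 ⟨x, hx, Metric.mem_ball.1 hz⟩)
    exact ((hseg _ _ fun z hz => Or.inr (Or.inl hz)).trans hmiddle).trans
      (hseg _ _ fun z hz => Or.inr (Or.inr hz)).symm
  have hpoly := fun e => exists_isSimplePolyline (hreach e) (hη e) le_rfl
  choose m b hm hb0 hbm hbQ hsimple using hpoly
  exact ⟨⟨d.point, src, tgt, m, b, d.point_injective, hmk, hm, hb0, hbm, hsimple,
    fun e X i hi hX => hPQ e X (hbQ e i hi hX),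
    fun e f hef i hi j hj z hz hz' => hQQ e f hef z (hbQ e i hi hz) (hbQ f j hj hz')⟩⟩

end SimpleGraph

namespace SimpleGraph
open Filter Topology

/-! ### Parallel strands -/

/-- At a corner of a simple polygonal line some vector points strictly to the left of both
segments. -/
theorem exists_cross_pos {a b c : Plane} (h : c ∉ segment ℝ a b) (h' : a ∉ segment ℝ b c) :
    ∃ n, 0 < cross (b - a) n ∧ 0 < cross (c - b) n := by
  rcases lt_trichotomy (cross (b - a) (c - b)) 0 with hc | hc | hc
  · -- a turn to the right; for a turn to the left the difference is taken the other way
    refine ⟨(b - a) - (c - b), ?_, ?_⟩ <;> simp only [cross, PiLp.sub_apply] at hc ⊢ <;> linarith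
  · set u := b - a with hu
    set w := c - b with hw
    have hu0 : u ≠ 0 := by
      intro h0
      rw [hu, sub_eq_zero] at h0
      exact h' (h0 ▸ left_mem_segment ℝ _ _)
    have hw0 : w ≠ 0 := by
      intro h0
      rw [hw, sub_eq_zero] at h0
      exact h (h0 ▸ right_mem_segment ℝ _ _)
    have hN : 0 < u 0 ^ 2 + u 1 ^ 2 := by
      by_contra! hle
      apply hu0
      ext i
      have h0 : u 0 = 0 := by nlinarith [sq_nonneg (u 0), sq_nonneg (u 1)]
      have h1 : u 1 = 0 := by nlinarith [sq_nonneg (u 0), sq_nonneg (u 1)]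
      fin_cases i
      · exact h0
      · exact h1
    obtain ⟨l, hl⟩ : ∃ l : ℝ, w = l • u := by
      refine ⟨(u 0 * w 0 + u 1 * w 1) / (u 0 ^ 2 + u 1 ^ 2), ?_⟩
      simp only [cross] at hc
      ext i
      fin_cases i
      · simp only [Fin.zero_eta, PiLp.smul_apply, smul_eq_mul]
        field_simp
        linear_combination (-u 1) * hc
      · simp only [Fin.mk_one, PiLp.smul_apply, smul_eq_mul]
        field_simp
        linear_combination u 0 * hc
    -- the line does not turn back
    have hlpos : 0 < l := by
      by_contra! hle
      have hl0 : l ≠ 0 := by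
        rintro rfl
        exact hw0 (by simpa using hl)
      rcases le_total (-1) l with h1 | h1
      · apply h
        rw [segment_eq_image']
        refine ⟨1 + l, ⟨by linarith, by linarith⟩, ?_⟩
        have : c = b + l • u := by rw [← hl, hw]; abel
        simp only [this, add_smul, one_smul, ← hu]
        rw [hu]; abel
      · apply h'
        rw [segment_eq_image']
        refine ⟨-l⁻¹, ⟨by simpa using hle, ?_⟩, ?_⟩
        · rw [← inv_neg]
          exact inv_le_one_of_one_le₀ (by linarith)
        · simp only [← hw, hl, smul_smul, neg_mul, inv_mul_cancel₀ hl0, neg_smul, one_smul]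
          rw [hu]; abel
    refine ⟨!₂[-u 1, u 0], ?_, ?_⟩
    · simp only [cross, Matrix.cons_val_zero, Matrix.cons_val_one]
      nlinarith
    · rw [hl]
      simp only [cross, PiLp.smul_apply, smul_eq_mul, Matrix.cons_val_zero, Matrix.cons_val_one]
      nlinarith [mul_pos hlpos hN]
  · refine ⟨(c - b) - (b - a), ?_, ?_⟩ <;> simp only [cross, PiLp.sub_apply] at hc ⊢ <;> linarith

/-- Two segments that end at different points of a line, and approach it from different sides, are
disjoint. -/
theorem disjoint_segment_of_cross_pos {a b c n : Plane} {s s' : ℝ} (hs : s ≠ s')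
    (h : 0 < cross (b + s • n - a) n) (h' : 0 < cross (c - (b + s' • n)) n) :
    Disjoint (segment ℝ a (b + s • n)) (segment ℝ (b + s' • n) c) := by
  rw [Set.disjoint_left]
  intro z hz hz'
  rw [segment_symm, segment_eq_image'] at hz
  rw [segment_eq_image'] at hz'
  obtain ⟨α, ⟨hα, -⟩, rfl⟩ := hz
  obtain ⟨β, ⟨hβ, -⟩, he⟩ := hz'
  have e0 := congrArg (fun v : Plane => v 0) he
  have e1 := congrArg (fun v : Plane => v 1) he
  simp only [cross, PiLp.add_apply, PiLp.sub_apply, PiLp.smul_apply, smul_eq_mul] at e0 e1 h h'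
  -- the two sides of the equation, as heights over the line, have opposite signs
  have hsum : β * ((c 0 - (b 0 + s' * n 0)) * n 1 - (c 1 - (b 1 + s' * n 1)) * n 0) +
      α * ((b 0 + s * n 0 - a 0) * n 1 - (b 1 + s * n 1 - a 1) * n 0) = 0 := by
    linear_combination n 1 * e0 - n 0 * e1
  have h1 := mul_nonneg hβ h'.le
  have h2 := mul_nonneg hα h.le
  have hα0 : α = 0 := (mul_eq_zero.1 (le_antisymm (by linarith) h2)).resolve_right h.ne'
  have hβ0 : β = 0 := (mul_eq_zero.1 (le_antisymm (by linarith) h1)).resolve_right h'.ne'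
  rw [hα0, hβ0] at e0 e1
  have hss : s' - s ≠ 0 := sub_ne_zero.2 hs.symm
  have n0 : n 0 = 0 := (mul_eq_zero.1 (by linarith : (s' - s) * n 0 = 0)).resolve_left hss
  have n1 : n 1 = 0 := (mul_eq_zero.1 (by linarith : (s' - s) * n 1 = 0)).resolve_left hss
  rw [n0, n1] at h
  simp at h

/-- Shifting the ends of a segment by different multiples of two vectors that point to the same side of
it gives disjoint segments. -/
theorem disjoint_segment_of_parallel {a b n n' : Plane} {s s' : ℝ} (hs : s ≠ s')
    (h : 0 < cross (b + s • n' - (a + s • n)) n) (h' : 0 < cross (b + s • n' - (a + s • n)) n') :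
    Disjoint (segment ℝ (a + s • n) (b + s • n')) (segment ℝ (a + s' • n) (b + s' • n')) := by
  rw [Set.disjoint_left]
  intro z hz hz'
  rw [segment_eq_image'] at hz hz'
  obtain ⟨α, -, rfl⟩ := hz
  obtain ⟨β, ⟨hβ, hβ1⟩, he⟩ := hz'
  have e0 := congrArg (fun v : Plane => v 0) he
  have e1 := congrArg (fun v : Plane => v 1) he
  simp only [cross, PiLp.add_apply, PiLp.sub_apply, PiLp.smul_apply, smul_eq_mul] at e0 e1 h h'
  set x := b 0 + s * n' 0 - (a 0 + s * n 0) with hx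
  set y := b 1 + s * n' 1 - (a 1 + s * n 1) with hy
  have hpos : 0 < (1 - β) * (x * n 1 - y * n 0) + β * (x * n' 1 - y * n' 0) := by
    rcases hβ.eq_or_lt with rfl | hlt
    · simpa using h
    · exact add_pos_of_nonneg_of_pos (mul_nonneg (by linarith) h.le) (mul_pos hlt h')
  have hss : s' - s ≠ 0 := sub_ne_zero.2 hs.symm
  refine hpos.ne' (mul_left_cancel₀ hss ?_)
  rw [mul_zero]
  linear_combination x * e1 - y * e0 + (α - β) * (x * hy - y * hx)

/-- Disjoint segments stay disjoint under small perturbations of their ends. -/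
theorem exists_perturbation_bound {W : Type*} [Finite W] (q : W → Plane) :
    ∃ δ > 0, ∀ p : W → Plane, (∀ x, Dist.dist (p x) (q x) < δ) → ∀ x y x' y',
      Disjoint (segment ℝ (q x) (q y)) (segment ℝ (q x') (q y')) →
        Disjoint (segment ℝ (p x) (p y)) (segment ℝ (p x') (p y')) := by
  have hev : ∀ᶠ δ in 𝓝[>] (0 : ℝ), ∀ x y x' y',
      Disjoint (segment ℝ (q x) (q y)) (segment ℝ (q x') (q y')) →
        Disjoint (Metric.thickening δ (segment ℝ (q x) (q y)))
          (Metric.thickening δ (segment ℝ (q x') (q y'))) := by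
    refine eventually_all.2 fun x => eventually_all.2 fun y => eventually_all.2 fun x' =>
      eventually_all.2 fun y' => ?_
    by_cases h : Disjoint (segment ℝ (q x) (q y)) (segment ℝ (q x') (q y'))
    · filter_upwards [eventually_disjoint_thickening h (isCompact_segment _ _)
        (isCompact_segment _ _).isClosed] with δ hδ _
      exact hδ
    · simp [h]
  obtain ⟨δ, hδ, h0⟩ := (hev.and self_mem_nhdsWithin).exists
  refine ⟨δ, h0, fun p hp x y x' y' hd => (hδ x y x' y' hd).mono ?_ ?_⟩
  all_goals
    refine ((convex_segment _ _).thickening δ).segment_subset ?_ ?_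
    · exact Metric.mem_thickening_iff.2 ⟨_, left_mem_segment _ _ _, hp _⟩
    · exact Metric.mem_thickening_iff.2 ⟨_, right_mem_segment _ _ _, hp _⟩

namespace PolygonalDrawing

variable {V B : Type*} {D : SimpleGraph B} (P : PolygonalDrawing D)

/-- The vertices of the blow-up of a polygonal drawing: one copy of each element of `V` at each
vertex of `D`, and one copy of each corner of each edge of `D` for each pair of elements of `V`. -/
abbrev BlowupVertex (V : Type*) {B : Type*} {D : SimpleGraph B} (P : PolygonalDrawing D) :
    Type _ :=
  (B × V) ⊕ (Σ e : D.edgeSet, (V × V) × Fin (P.len e))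

/-- The `j`-th vertex of the strand along the edge `e` from the first component of `i`, at the start
of `e`, to the second component, at the end of `e`. The copies of the corner `0` are not used. -/
def strand (e : D.edgeSet) (i : V × V) (j : ℕ) : P.BlowupVertex V :=
  if j = 0 then .inl (P.src e, i.1)
  else if h : j < P.len e then .inr ⟨e, i, ⟨j, h⟩⟩ else .inl (P.tgt e, i.2)

theorem strand_zero (e : D.edgeSet) (i : V × V) : P.strand e i 0 = .inl (P.src e, i.1) := rfl

theorem strand_len (e : D.edgeSet) (i : V × V) :
    P.strand e i (P.len e) = .inl (P.tgt e, i.2) := by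
  have := P.two_le_len e
  rw [strand, if_neg (by omega), dif_neg (lt_irrefl _)]

theorem strand_of_lt {e : D.edgeSet} (i : V × V) {j : ℕ} (h0 : 0 < j) (h : j < P.len e) :
    P.strand e i j = .inr ⟨e, i, ⟨j, h⟩⟩ := by
  rw [strand, if_neg h0.ne', dif_pos h]

/-- The point of the drawing of `D` near which a vertex of the blow-up is placed. -/
def base : P.BlowupVertex V → Plane
  | .inl x => P.point x.1
  | .inr x => P.corner x.1 x.2.2

/-- The shifted position of a vertex of the blow-up: the corner `j` of a strand with index `i` moves
by `t i` times the vector `n e j`. -/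
def shifted (n : D.edgeSet → ℕ → Plane) (t : V × V → ℝ) : P.BlowupVertex V → Plane
  | .inl x => P.point x.1
  | .inr x => P.corner x.1 x.2.2 + t x.2.1 • n x.1 x.2.2

theorem base_strand (e : D.edgeSet) (i : V × V) {j : ℕ} (hj : j ≤ P.len e) :
    P.base (P.strand e i j) = P.corner e j := by
  rcases Nat.eq_zero_or_pos j with rfl | h0
  · rw [strand_zero, corner_zero]; rfl
  rcases hj.eq_or_lt with rfl | h
  · rw [strand_len, corner_len]; rfl
  · rw [P.strand_of_lt i h0 h]; rfl

theorem shifted_strand {n : D.edgeSet → ℕ → Plane} (hn0 : ∀ e, n e 0 = 0)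
    (hn : ∀ e, n e (P.len e) = 0) (t : V × V → ℝ) (e : D.edgeSet) (i : V × V) {j : ℕ}
    (hj : j ≤ P.len e) :
    P.shifted n t (P.strand e i j) = P.corner e j + t i • n e j := by
  rcases Nat.eq_zero_or_pos j with rfl | h0
  · rw [strand_zero, corner_zero, hn0, smul_zero, add_zero]; rfl
  rcases hj.eq_or_lt with rfl | h
  · rw [strand_len, corner_len, hn, smul_zero, add_zero]; rfl
  · rw [P.strand_of_lt i h0 h]; rfl

/-- Vectors at the corners that point to the left of both segments at the corner, and vanish at the
ends of the edges. -/
theorem exists_normals : ∃ n : D.edgeSet → ℕ → Plane, (∀ e, n e 0 = 0) ∧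
    (∀ e, n e (P.len e) = 0) ∧ ∀ e j, j + 2 ≤ P.len e →
      0 < cross (P.corner e (j + 1) - P.corner e j) (n e (j + 1)) ∧
      0 < cross (P.corner e (j + 2) - P.corner e (j + 1)) (n e (j + 1)) := by
  have h : ∀ e j, ∃ n : Plane, (j = 0 → n = 0) ∧ (j = P.len e → n = 0) ∧
      ∀ i, j = i + 1 → i + 2 ≤ P.len e → 0 < cross (P.corner e (i + 1) - P.corner e i) n ∧
        0 < cross (P.corner e (i + 2) - P.corner e (i + 1)) n := by
    intro e j
    by_cases hj : j = 0 ∨ P.len e ≤ j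
    · exact ⟨0, fun _ => rfl, fun _ => rfl, fun i h1 h2 => by omega⟩
    · obtain ⟨i, rfl⟩ : ∃ i, j = i + 1 := ⟨j - 1, by omega⟩
      obtain ⟨n, hn⟩ := exists_cross_pos ((P.simple e).notMem_left i (by omega))
        ((P.simple e).notMem_right i (by omega))
      refine ⟨n, by omega, by omega, fun i' h1 h2 => ?_⟩
      obtain rfl : i = i' := by omega
      exact hn
  choose n h0 h1 h2 using h
  exact ⟨n, fun e => h0 e 0 rfl, fun e => h1 e _ rfl, fun e j hj => h2 e (j + 1) j rfl hj⟩

/-- The blow-up has a placement in general position in which disjointness of segments is inherited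
from the drawing of `D`, and different strands along an edge of `D` are disjoint except in their
first and last segments. -/
theorem exists_placement [Finite V] [Finite B] :
    ∃ p : P.BlowupVertex V → Plane, GeneralPosition p ∧
      (∀ x y x' y', Disjoint (segment ℝ (P.base x) (P.base y)) (segment ℝ (P.base x') (P.base y')) →
        Disjoint (segment ℝ (p x) (p y)) (segment ℝ (p x') (p y'))) ∧
      (∀ e i i' j, i ≠ i' → j + 2 ≤ P.len e →
        Disjoint (segment ℝ (p (P.strand e i j)) (p (P.strand e i (j + 1))))
          (segment ℝ (p (P.strand e i' (j + 1))) (p (P.strand e i' (j + 2))))) ∧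
      (∀ e i i' j, i ≠ i' → 0 < j → j + 2 ≤ P.len e →
        Disjoint (segment ℝ (p (P.strand e i j)) (p (P.strand e i (j + 1))))
          (segment ℝ (p (P.strand e i' j)) (p (P.strand e i' (j + 1))))) := by
  obtain ⟨δ, hδ, hbase⟩ := exists_perturbation_bound (P.base (V := V))
  obtain ⟨n, hn0, hnl, hn⟩ := P.exists_normals
  obtain ⟨t, ht⟩ : ∃ t : V × V → ℝ, Function.Injective t := by
    obtain ⟨k, ⟨f⟩⟩ := Finite.exists_equiv_fin (V × V)
    exact ⟨fun i => ((f i : ℕ) : ℝ),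
      Nat.cast_injective.comp (Fin.val_injective.comp f.injective)⟩
  have hev1 : ∀ᶠ τ in 𝓝[>] (0 : ℝ), ∀ x : P.BlowupVertex V,
      Dist.dist (P.shifted n (fun i => τ * t i) x) (P.base x) < δ / 2 := by
    refine eventually_all.2 fun x => nhdsWithin_le_nhds ?_
    rcases x with x | x
    · refine Eventually.of_forall fun τ => ?_
      simp only [shifted, base, _root_.dist_self]
      linarith
    · have hc : Continuous fun τ : ℝ =>
          Dist.dist (P.corner x.1 x.2.2 + (τ * t x.2.1) • n x.1 x.2.2) (P.corner x.1 x.2.2) := by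
        fun_prop
      exact hc.tendsto 0 |>.eventually_lt_const (by simpa using half_pos hδ)
  have hev2 : ∀ᶠ τ in 𝓝[>] (0 : ℝ), ∀ e, ∀ i, ∀ j ∈ Finset.range (P.len e - 1),
      0 < cross (P.corner e (j + 1) + (τ * t i) • n e (j + 1) -
          (P.corner e j + (τ * t i) • n e j)) (n e (j + 1)) ∧
        0 < cross (P.corner e (j + 2) + (τ * t i) • n e (j + 2) -
          (P.corner e (j + 1) + (τ * t i) • n e (j + 1))) (n e (j + 1)) := by
    refine eventually_all.2 fun e => eventually_all.2 fun i =>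
      (Finset.eventually_all _).2 fun j hj => nhdsWithin_le_nhds ?_
    have hj' : j + 2 ≤ P.len e := by
      have := Finset.mem_range.1 hj
      omega
    have hc : ∀ a b c d m : Plane, 0 < cross (b - a) m →
        ∀ᶠ τ in 𝓝 (0 : ℝ), 0 < cross (b + (τ * t i) • d - (a + (τ * t i) • c)) m := by
      intro a b c d m h
      have hc : Continuous fun τ : ℝ => cross (b + (τ * t i) • d - (a + (τ * t i) • c)) m := by
        unfold cross
        fun_prop
      exact hc.tendsto 0 |>.eventually_const_lt (by simpa using h)
    exact (hc _ _ _ _ _ (hn e j hj').1).and (hc _ _ _ _ _ (hn e j hj').2)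
  obtain ⟨τ, ⟨hτ1, hτ2⟩, hτ⟩ := ((hev1.and hev2).and self_mem_nhdsWithin).exists
  have hτ0 : τ ≠ 0 := ne_of_gt hτ
  obtain ⟨δ', hδ', hshift⟩ := exists_perturbation_bound (P.shifted n (fun i => τ * t i))
  obtain ⟨p, hp, hgen⟩ := exists_near_generalPosition (P.shifted n (fun i => τ * t i))
    (lt_min (half_pos hδ) hδ')
  have hne : ∀ i i', i ≠ i' → τ * t i ≠ τ * t i' := fun i i' h h' =>
    h (ht (mul_left_cancel₀ hτ0 h'))
  refine ⟨p, hgen, fun x y x' y' h => hbase p (fun x => ?_) x y x' y' h,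
    fun e i i' j hi hj => ?_, fun e i i' j hi h0 hj => ?_⟩
  · have h1 := (hp x).trans_le (min_le_left _ _)
    have h2 := hτ1 x
    have := _root_.dist_triangle (p x) (P.shifted n (fun i => τ * t i) x) (P.base x)
    linarith
  · apply hshift p (fun x => (hp x).trans_le (min_le_right _ _))
    rw [P.shifted_strand hn0 hnl _ e i (by omega), P.shifted_strand hn0 hnl _ e i (by omega),
      P.shifted_strand hn0 hnl _ e i' (by omega), P.shifted_strand hn0 hnl _ e i' (by omega)]
    have hj' : j ∈ Finset.range (P.len e - 1) := Finset.mem_range.2 (by omega)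
    exact disjoint_segment_of_cross_pos (hne i i' hi) (hτ2 e i j hj').1 (hτ2 e i' j hj').2
  · apply hshift p (fun x => (hp x).trans_le (min_le_right _ _))
    rw [P.shifted_strand hn0 hnl _ e i (by omega), P.shifted_strand hn0 hnl _ e i (by omega),
      P.shifted_strand hn0 hnl _ e i' (by omega), P.shifted_strand hn0 hnl _ e i' (by omega)]
    obtain ⟨k, rfl⟩ : ∃ k, j = k + 1 := ⟨j - 1, by omega⟩
    exact disjoint_segment_of_parallel (hne i i' hi)
      (hτ2 e i k (Finset.mem_range.2 (by omega))).2
      (hτ2 e i (k + 1) (Finset.mem_range.2 (by omega))).1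

end PolygonalDrawing
end SimpleGraph

namespace SimpleGraph
namespace PolygonalDrawing

/-! ### The blow-up of a planar graph -/

variable {V B : Type*} {D : SimpleGraph B} (P : PolygonalDrawing D)

/-- The possible edges of the blow-up: `.inl (X, v, w)` joins the copies of `v` and `w` at the vertex
`X`, and `.inr ⟨e, i, j⟩` is the `j`-th edge of the strand with index `i` along `e`. -/
abbrev Link (V : Type*) {B : Type*} {D : SimpleGraph B} (P : PolygonalDrawing D) : Type _ :=
  (B × V × V) ⊕ (Σ e : D.edgeSet, (V × V) × Fin (P.len e))

/-- The first end of a link. -/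
def lo : P.Link V → P.BlowupVertex V
  | .inl x => .inl (x.1, x.2.1)
  | .inr x => P.strand x.1 x.2.1 x.2.2

/-- The second end of a link. -/
def hi : P.Link V → P.BlowupVertex V
  | .inl x => .inl (x.1, x.2.2)
  | .inr x => P.strand x.1 x.2.1 (x.2.2 + 1)

/-- A link is local at `X` if it runs inside the disc around `X` or leaves it. -/
def IsLocal : P.Link V → B → Prop
  | .inl x, X => x.1 = X
  | .inr x, X => (X = P.src x.1 ∧ (x.2.2 : ℕ) = 0) ∨ (X = P.tgt x.1 ∧ (x.2.2 : ℕ) + 1 = P.len x.1)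

/-- The links whose ends come from the bags. -/
def Valid (bag : B → Finset V) : P.Link V → Prop
  | .inl x => x.2.1 ∈ bag x.1 ∧ x.2.2 ∈ bag x.1
  | .inr x => x.2.1.1 ∈ bag (P.src x.1) ∧ x.2.1.2 ∈ bag (P.tgt x.1)

/-- The blow-up: the graph formed by the valid links. -/
def blowup (bag : B → Finset V) : SimpleGraph (P.BlowupVertex V) :=
  fromEdgeSet {e | ∃ a, P.Valid bag a ∧ e = s(P.lo a, P.hi a)}

theorem isLocal_of_point_mem {a : P.Link V} {X : B}
    (h : P.point X ∈ segment ℝ (P.base (P.lo a)) (P.base (P.hi a))) : P.IsLocal a X := by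
  rcases a with x | ⟨e, i, j, hj⟩
  · simp only [lo, hi, base, segment_same, Set.mem_singleton_iff] at h
    exact (P.point_injective h).symm
  · simp only [lo, hi] at h
    rw [P.base_strand e i (by omega), P.base_strand e i (by omega)] at h
    have hs := P.simple e
    rcases P.eq_end_of_mem e X j hj h with rfl | rfl
    · refine Or.inl ⟨rfl, ?_⟩
      rw [← P.corner_zero] at h
      by_contra hj0
      simp only at hj0
      rcases (show j = 1 ∨ 2 ≤ j by omega) with rfl | hj2
      · exact hs.notMem_right 0 (by omega) h
      · exact Set.disjoint_left.1 (hs.disjoint 0 j (by omega) hj) (left_mem_segment _ _ _) h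
    · refine Or.inr ⟨rfl, ?_⟩
      rw [← P.corner_len] at h
      by_contra hj0
      simp only at hj0
      rcases (show P.len e = j + 2 ∨ j + 3 ≤ P.len e by omega) with hl | hl
      · rw [hl] at h
        exact hs.notMem_left j (by omega) h
      · refine Set.disjoint_left.1 (hs.disjoint j (P.len e - 1) (by omega) (by omega)) h ?_
        rw [Nat.sub_add_cancel (by omega)]
        exact right_mem_segment _ _ _

/-- Two links whose base segments meet are local at a common vertex of `D`, or belong to neighbouring
segments of one edge of `D`. -/
theorem local_or_near {a a' : P.Link V}
    (h : ¬ Disjoint (segment ℝ (P.base (P.lo a)) (P.base (P.hi a)))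
      (segment ℝ (P.base (P.lo a')) (P.base (P.hi a')))) :
    (∃ X, P.IsLocal a X ∧ P.IsLocal a' X) ∨ ∃ e i i' j j', a = .inr ⟨e, i, j⟩ ∧
      a' = .inr ⟨e, i', j'⟩ ∧ (j : ℕ) ≤ j' + 1 ∧ (j' : ℕ) ≤ j + 1 := by
  obtain ⟨z, hz, hz'⟩ := Set.not_disjoint_iff.1 h
  have key : z ∈ Set.range P.point → ∃ X, P.IsLocal a X ∧ P.IsLocal a' X := by
    rintro ⟨X, rfl⟩
    exact ⟨X, P.isLocal_of_point_mem hz, P.isLocal_of_point_mem hz'⟩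
  rcases a with x | ⟨e, i, j, hj⟩
  · simp only [lo, hi, base, segment_same, Set.mem_singleton_iff] at hz
    exact Or.inl (key ⟨_, hz.symm⟩)
  rcases a' with x | ⟨f, i', j', hj'⟩
  · simp only [lo, hi, base, segment_same, Set.mem_singleton_iff] at hz'
    exact Or.inl (key ⟨_, hz'.symm⟩)
  simp only [lo, hi] at hz hz'
  rw [P.base_strand e i (by omega), P.base_strand e i (by omega)] at hz
  rw [P.base_strand f i' (by omega), P.base_strand f i' (by omega)] at hz'
  by_cases hef : e = f
  · subst hef
    refine Or.inr ⟨e, i, i', ⟨j, hj⟩, ⟨j', hj'⟩, rfl, rfl, ?_, ?_⟩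
    · by_contra! hlt
      exact Set.disjoint_left.1 ((P.simple e).disjoint j' j hlt hj) hz' hz
    · by_contra! hlt
      exact Set.disjoint_left.1 ((P.simple e).disjoint j j' hlt hj') hz hz'
  · exact Or.inl (key (P.mem_range_of_mem e f hef j hj j' hj' z hz hz'))

/-- In a suitable placement of the blow-up in general position, links without a common end cross only
if they are local at a common vertex of `D`. -/
theorem exists_placement_local [Finite V] [Finite B] :
    ∃ p : P.BlowupVertex V → Plane, GeneralPosition p ∧ ∀ a a' : P.Link V,
      P.lo a ≠ P.lo a' → P.lo a ≠ P.hi a' → P.hi a ≠ P.lo a' →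
        ¬ Disjoint (segment ℝ (p (P.lo a)) (p (P.hi a))) (segment ℝ (p (P.lo a')) (p (P.hi a'))) →
          ∃ X, P.IsLocal a X ∧ P.IsLocal a' X := by
  obtain ⟨p, hp, hbase, hcons, hpar⟩ := P.exists_placement (V := V)
  refine ⟨p, hp, fun a a' h1 h2 h3 hd => ?_⟩
  rcases P.local_or_near fun h => hd (hbase _ _ _ _ h) with h | ⟨e, i, i', j, j', rfl, rfl, hj, hj'⟩
  · exact h
  simp only [lo, hi] at h1 h2 h3 hd
  obtain ⟨j, hlt⟩ := j
  obtain ⟨j', hlt'⟩ := j'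
  simp only at h1 h2 h3 hd hj hj'
  rcases (show j = j' ∨ j' = j + 1 ∨ j = j' + 1 by omega) with rfl | rfl | rfl
  · have hi : i ≠ i' := by
      rintro rfl
      exact h1 rfl
    rcases Nat.eq_zero_or_pos j with rfl | h0
    · exact ⟨P.src e, Or.inl ⟨rfl, rfl⟩, Or.inl ⟨rfl, rfl⟩⟩
    rcases (show j + 1 = P.len e ∨ j + 2 ≤ P.len e by omega) with hl | hl
    · exact ⟨P.tgt e, Or.inr ⟨rfl, hl⟩, Or.inr ⟨rfl, hl⟩⟩
    · exact absurd (hpar e i i' j hi h0 hl) hd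
  · have hi : i ≠ i' := by
      rintro rfl
      exact h3 rfl
    exact absurd (hcons e i i' j hi (by omega)) hd
  · have hi : i' ≠ i := by
      rintro rfl
      exact h2 rfl
    exact absurd (hcons e i' i j' hi (by omega)).symm hd

/-- The links that are local at a vertex: `k ^ 2` of them at most inside its disc, and `k ^ 2` at most
for each edge of `D` at the vertex. -/
theorem exists_local_links [Fintype B] [DecidableRel D.Adj] {bag : B → Finset V} {k : ℕ}
    (hk : ∀ X, (bag X).card ≤ k) :
    ∃ L : B → Finset (P.Link V), (∀ a X, P.Valid bag a → P.IsLocal a X → a ∈ L X) ∧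
      ∀ X, (L X).card ≤ k ^ 2 * (D.maxDegree + 1) := by
  classical
  let last : ∀ e, Fin (P.len e) := fun e => ⟨P.len e - 1, by have := P.two_le_len e; omega⟩
  let first : ∀ e, Fin (P.len e) := fun e => ⟨0, by have := P.two_le_len e; omega⟩
  let I : B → Finset D.edgeSet := fun X => Finset.univ.filter fun e => X ∈ e.1
  let inner : B → Finset (P.Link V) := fun X =>
    (bag X ×ˢ bag X).image fun i => .inl (X, i)
  let outer : B → D.edgeSet → Finset (P.Link V) := fun X e =>
    (bag (P.src e) ×ˢ bag (P.tgt e)).image fun i =>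
      .inr ⟨e, i, if X = P.src e then first e else last e⟩
  have hst : ∀ e, P.src e ≠ P.tgt e := fun e => by
    have h := e.2
    rw [← P.mk_src_tgt e] at h
    exact Adj.ne (show D.Adj _ _ from h)
  have hI : ∀ X, (I X).card ≤ D.maxDegree := by
    intro X
    refine le_trans ?_ (D.degree_le_maxDegree X)
    rw [← D.card_incidenceFinset_eq_degree X]
    refine Finset.card_le_card_of_injOn Subtype.val (fun e he => ?_) Subtype.val_injective.injOn
    have he' : X ∈ e.1 := (Finset.mem_filter.1 he).2
    exact (D.mem_incidenceFinset X e.1).2 ⟨e.2, he'⟩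
  have hsq : ∀ X Y, (bag X ×ˢ bag Y).card ≤ k ^ 2 := by
    intro X Y
    rw [Finset.card_product, sq]
    exact Nat.mul_le_mul (hk X) (hk Y)
  refine ⟨fun X => inner X ∪ (I X).biUnion (outer X), ?_, fun X => ?_⟩
  · rintro (⟨Y, i⟩ | ⟨e, i, j⟩) X hv hl
    · obtain rfl : Y = X := hl
      exact Finset.mem_union_left _ (Finset.mem_image.2 ⟨i, Finset.mem_product.2 hv, rfl⟩)
    · refine Finset.mem_union_right _ (Finset.mem_biUnion.2 ⟨e, ?_, ?_⟩)
      · refine Finset.mem_filter.2 ⟨Finset.mem_univ _, ?_⟩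
        rw [← P.mk_src_tgt e, Sym2.mem_iff]
        exact hl.imp And.left And.left
      · refine Finset.mem_image.2 ⟨i, Finset.mem_product.2 hv, ?_⟩
        rcases hl with ⟨rfl, h⟩ | ⟨rfl, h⟩
        · rw [if_pos rfl, show first e = j from Fin.ext h.symm]
        · rw [if_neg (hst e).symm, show last e = j from Fin.ext (by simp only [last] at h ⊢; omega)]
  · have h1 : (inner X).card ≤ k ^ 2 := Finset.card_image_le.trans (hsq X X)
    have h2 : ((I X).biUnion (outer X)).card ≤ D.maxDegree * k ^ 2 :=
      (Finset.card_biUnion_le_card_mul _ _ _ fun e _ => Finset.card_image_le.trans (hsq _ _)).trans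
        (Nat.mul_le_mul_right _ (hI X))
    have h3 := Finset.card_union_le (inner X) ((I X).biUnion (outer X))
    nlinarith

/-- The blow-up has a drawing in which every crossing belongs to two links that are local at a common
vertex of `D`, and every such pair of links crosses at most once. -/
theorem exists_drawing_blowup [Finite V] [Fintype B] [DecidableRel D.Adj] {bag : B → Finset V}
    {k : ℕ} (hk : ∀ X, (bag X).card ≤ k) :
    ∃ d : Drawing (P.blowup bag),
      d.crossings.encard ≤ ((k ^ 4 * (D.maxDegree + 1) ^ 2 * Fintype.card B : ℕ) : ℕ∞) := by
  classical
  obtain ⟨p, hp, hloc⟩ := P.exists_placement_local (V := V)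
  obtain ⟨L, hL, hcard⟩ := P.exists_local_links hk
  let T : Finset (B × P.Link V × P.Link V) :=
    Finset.univ.biUnion fun X => (L X ×ˢ L X).image fun a => (X, a)
  have hT : T.card ≤ k ^ 4 * (D.maxDegree + 1) ^ 2 * Fintype.card B := by
    refine (Finset.card_biUnion_le_card_mul _ _ (k ^ 4 * (D.maxDegree + 1) ^ 2)
      fun X _ => ?_).trans (by rw [mul_comm, Finset.card_univ])
    refine Finset.card_image_le.trans ?_
    rw [Finset.card_product]
    exact (Nat.mul_le_mul (hcard X) (hcard X)).trans (by ring_nf; rfl)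
  have hcross : ∀ c ∈ (straightDrawing (P.blowup bag) hp).crossings, ∃ x ∈ T,
      c ∈ segment ℝ (p (P.lo x.2.1)) (p (P.hi x.2.1)) ∩
        segment ℝ (p (P.lo x.2.2)) (p (P.hi x.2.2)) ∧
      (segment ℝ (p (P.lo x.2.1)) (p (P.hi x.2.1)) ∩
        segment ℝ (p (P.lo x.2.2)) (p (P.hi x.2.2))).Subsingleton := by
    intro c hc
    obtain ⟨e, f, he, hf, hdis⟩ := exists_edges_of_mem_crossings hp hc
    have hlink : ∀ e : (P.blowup bag).edgeSet,
        ∃ a, P.Valid bag a ∧ e.1 = s(P.lo a, P.hi a) ∧ P.lo a ≠ P.hi a := by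
      rintro ⟨e, he⟩
      rw [blowup, edgeSet_fromEdgeSet] at he
      obtain ⟨⟨a, hv, rfl⟩, hd⟩ := he
      exact ⟨a, hv, rfl, fun h => hd h⟩
    obtain ⟨a, hva, hea, -⟩ := hlink e
    obtain ⟨a', hva', hfa, hne⟩ := hlink f
    rw [range_curve_straightDrawing hp hea] at he
    rw [range_curve_straightDrawing hp hfa] at hf
    rw [hea, hfa] at hdis
    simp only [Sym2.mem_iff, not_or, forall_eq_or_imp, forall_eq] at hdis
    obtain ⟨X, h1, h2⟩ := hloc a a' hdis.1.1 hdis.1.2 hdis.2.1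
      (Set.not_disjoint_iff.2 ⟨c, he, hf⟩)
    refine ⟨(X, a, a'), ?_, ⟨he, hf⟩, hp.subsingleton_inter hdis.1.1 hdis.1.2 hne⟩
    exact Finset.mem_biUnion.2 ⟨X, Finset.mem_univ _, Finset.mem_image.2
      ⟨(a, a'), Finset.mem_product.2 ⟨hL a X hva h1, hL a' X hva' h2⟩, rfl⟩⟩
  refine ⟨straightDrawing (P.blowup bag) hp, ?_⟩
  rcases (straightDrawing (P.blowup bag) hp).crossings.eq_empty_or_nonempty with h0 | ⟨c₀, hc₀⟩
  · rw [h0, Set.encard_empty]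
    exact zero_le
  obtain ⟨x₀, -⟩ := hcross c₀ hc₀
  have : Nonempty (B × P.Link V × P.Link V) := ⟨x₀⟩
  choose! g hgT hg hgs using hcross
  calc _ ≤ (T : Set (B × P.Link V × P.Link V)).encard :=
        Set.encard_le_encard_of_injOn hgT fun c hc c' hc' h =>
          hgs c hc (hg c hc) (h ▸ hg c' hc')
    _ = (T.card : ℕ∞) := Set.encard_coe_eq_coe_finsetCard T
    _ ≤ _ := by exact_mod_cast hT

end PolygonalDrawing
end SimpleGraph

namespace SimpleGraph
namespace PolygonalDrawing

/-! ### Branch sets in the blow-up -/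

variable {V B : Type*} {D : SimpleGraph B} (P : PolygonalDrawing D)

/-- The copies of elements of bags that serve as vertices of the branch sets. -/
def branchVertices (bag : B → Finset V) : Set (P.BlowupVertex V)
  | .inl x => x.2 ∈ bag x.1
  | .inr x => 0 < (x.2.2 : ℕ) ∧ x.2.1.1 ∈ bag (P.src x.1) ∧ x.2.1.2 ∈ bag (P.tgt x.1)

/-- The element of `V` to whose branch set a vertex of the blow-up belongs: the inner vertices of a
strand go to its first end. -/
def label : P.BlowupVertex V → V
  | .inl x => x.2
  | .inr x => x.2.1.1

theorem exists_edge {X Y : B} (h : D.Adj X Y) :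
    ∃ e, (P.src e = X ∧ P.tgt e = Y) ∨ (P.src e = Y ∧ P.tgt e = X) :=
  ⟨⟨s(X, Y), h⟩, Sym2.eq_iff.1 (P.mk_src_tgt ⟨s(X, Y), h⟩)⟩

variable {P} {bag : B → Finset V}

theorem strand_mem_branchVertices {e : D.edgeSet} {i : V × V} (h1 : i.1 ∈ bag (P.src e))
    (h2 : i.2 ∈ bag (P.tgt e)) (j : ℕ) : P.strand e i j ∈ P.branchVertices bag := by
  unfold strand
  split_ifs with hj0 hj
  · exact h1
  · exact ⟨Nat.pos_of_ne_zero hj0, h1, h2⟩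
  · exact h2

theorem label_strand {e : D.edgeSet} {i : V × V} {j : ℕ} (hj : j < P.len e) :
    P.label (P.strand e i j) = i.1 := by
  unfold strand
  split_ifs
  · rfl
  · rfl

theorem blowup_adj_strand {e : D.edgeSet} {i : V × V} (h1 : i.1 ∈ bag (P.src e))
    (h2 : i.2 ∈ bag (P.tgt e)) {j : ℕ} (hj : j < P.len e) :
    (P.blowup bag).Adj (P.strand e i j) (P.strand e i (j + 1)) := by
  refine (fromEdgeSet_adj _).2 ⟨⟨.inr ⟨e, i, ⟨j, hj⟩⟩, ⟨h1, h2⟩, rfl⟩, ?_⟩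
  have := P.two_le_len e
  rcases Nat.eq_zero_or_pos j with rfl | h0
  · rw [strand_zero, P.strand_of_lt i (by omega) (by omega)]
    exact Sum.inl_ne_inr
  rcases (show j + 1 = P.len e ∨ j + 1 < P.len e by omega) with h | h
  · rw [h, strand_len, P.strand_of_lt i h0 hj]
    exact Sum.inr_ne_inl
  · rw [P.strand_of_lt i h0 hj, P.strand_of_lt i (by omega) h]
    simp

theorem reachable_strand {e : D.edgeSet} {i : V × V} (h1 : i.1 ∈ bag (P.src e))
    (h2 : i.2 ∈ bag (P.tgt e)) {j : ℕ} (hj : j < P.len e) :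
    (fibreGraph (P.blowup bag) (P.branchVertices bag) P.label).Reachable
      (.inl (P.src e, i.1)) (P.strand e i j) := by
  induction j with
  | zero => rfl
  | succ j ih =>
    refine (ih (by omega)).trans (Adj.reachable ?_)
    exact ⟨blowup_adj_strand h1 h2 (by omega), strand_mem_branchVertices h1 h2 _,
      strand_mem_branchVertices h1 h2 _, by rw [label_strand (by omega), label_strand hj]⟩

theorem blowup_adj_last {e : D.edgeSet} {i : V × V} (h1 : i.1 ∈ bag (P.src e))
    (h2 : i.2 ∈ bag (P.tgt e)) :
    (P.blowup bag).Adj (P.strand e i (P.len e - 1)) (.inl (P.tgt e, i.2)) := by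
  have := P.two_le_len e
  have h := blowup_adj_strand h1 h2 (show P.len e - 1 < P.len e by omega)
  rwa [Nat.sub_add_cancel (by omega), strand_len] at h

/-- The copies of `v` at adjacent vertices of `D` are joined by the strand with index `(v, v)`. -/
theorem reachable_of_adj {X Y : B} (hXY : D.Adj X Y) {v : V} (hX : v ∈ bag X) (hY : v ∈ bag Y) :
    (fibreGraph (P.blowup bag) (P.branchVertices bag) P.label).Reachable
      (.inl (X, v)) (.inl (Y, v)) := by
  have key : ∀ e : D.edgeSet, v ∈ bag (P.src e) → v ∈ bag (P.tgt e) →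
      (fibreGraph (P.blowup bag) (P.branchVertices bag) P.label).Reachable
        (.inl (P.src e, v)) (.inl (P.tgt e, v)) := by
    intro e h1 h2
    have := P.two_le_len e
    refine (reachable_strand (i := (v, v)) h1 h2 (show P.len e - 1 < P.len e by omega)).trans
      (Adj.reachable ?_)
    exact ⟨blowup_adj_last (i := (v, v)) h1 h2, strand_mem_branchVertices h1 h2 _, h2,
      label_strand (by omega)⟩
  obtain ⟨e, ⟨rfl, rfl⟩ | ⟨rfl, rfl⟩⟩ := P.exists_edge hXY
  · exact key e hX hY
  · exact (key e hY hX).symm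

variable (P) in
/-- The blow-up with respect to the bags of a decomposition of `G` contains `G` as a minor. -/
theorem minorCrossingNumber_le [Finite V] [Finite B] {G : SimpleGraph V} (𝒟 : Decomposition G D)
    (d : Drawing (P.blowup 𝒟.bag)) : G.minorCrossingNumber ≤ d.crossings.encard := by
  refine minorCrossingNumber_le_of_branchSets (P.branchVertices 𝒟.bag) P.label ?_ ?_ ?_ d
  · intro v
    obtain ⟨X, hX⟩ := (𝒟.connected v).nonempty
    exact ⟨.inl (X, v), hX, rfl⟩
  · have hhub : ∀ x ∈ P.branchVertices 𝒟.bag, ∃ X, P.label x ∈ 𝒟.bag X ∧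
        (fibreGraph (P.blowup 𝒟.bag) (P.branchVertices 𝒟.bag) P.label).Reachable
          (.inl (X, P.label x)) x := by
      rintro (⟨X, v⟩ | ⟨e, i, j, hj⟩) hx
      · exact ⟨X, hx, Reachable.refl _⟩
      · have h := reachable_strand hx.2.1 hx.2.2 hj
        rw [P.strand_of_lt i hx.1 hj] at h
        exact ⟨P.src e, hx.2.1, h⟩
    have hhubs : ∀ v X Y, v ∈ 𝒟.bag X → v ∈ 𝒟.bag Y →
        (fibreGraph (P.blowup 𝒟.bag) (P.branchVertices 𝒟.bag) P.label).Reachable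
          (.inl (X, v)) (.inl (Y, v)) := by
      intro v X Y hX hY
      obtain ⟨p⟩ := (𝒟.connected v).coe.preconnected ⟨X, hX⟩ ⟨Y, hY⟩
      have key : ∀ (a b : (bagSubgraph D 𝒟.bag v).verts),
          (bagSubgraph D 𝒟.bag v).coe.Walk a b →
          (fibreGraph (P.blowup 𝒟.bag) (P.branchVertices 𝒟.bag) P.label).Reachable
            (.inl (a.1, v)) (.inl (b.1, v)) := by
        intro a b p
        induction p with
        | nil => rfl
        | @cons a b c h p ih => exact (reachable_of_adj ((bagSubgraph D 𝒟.bag v).adj_sub h) a.2 b.2).trans ih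
      exact key _ _ p
    intro x hx y hy hxy
    obtain ⟨X, hX, h1⟩ := hhub x hx
    obtain ⟨Y, hY, h2⟩ := hhub y hy
    rw [hxy] at hX h1
    exact (h1.symm.trans (hhubs _ _ _ hX hY)).trans h2
  · intro v w hvw
    rcases 𝒟.touch v w hvw with ⟨X, hv, hw⟩ | ⟨X, hv, Y, hw, hXY⟩
    · refine ⟨.inl (X, v), hv, .inl (X, w), hw, rfl, rfl, (fromEdgeSet_adj _).2
        ⟨⟨.inl (X, v, w), ⟨hv, hw⟩, rfl⟩, fun h => hvw.ne ?_⟩⟩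
      exact congrArg P.label h
    · have key : ∀ (e : D.edgeSet) v w, v ∈ 𝒟.bag (P.src e) → w ∈ 𝒟.bag (P.tgt e) →
          ∃ x ∈ P.branchVertices 𝒟.bag, ∃ y ∈ P.branchVertices 𝒟.bag,
            P.label x = v ∧ P.label y = w ∧ (P.blowup 𝒟.bag).Adj x y := by
        intro e v w h1 h2
        have := P.two_le_len e
        exact ⟨P.strand e (v, w) (P.len e - 1), strand_mem_branchVertices h1 h2 _,
          .inl (P.tgt e, w), h2, label_strand (by omega), rfl, blowup_adj_last h1 h2⟩
      obtain ⟨e, ⟨rfl, rfl⟩ | ⟨rfl, rfl⟩⟩ := P.exists_edge hXY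
      · exact key e v w hv hw
      · obtain ⟨x, hx, y, hy, hxw, hyv, hxy⟩ := key e w v hw hv
        exact ⟨y, hy, x, hx, hyv, hxw, hxy.symm⟩

end PolygonalDrawing
end SimpleGraph

theorem mainTheorem4 {V B : Type*} [Finite V] [Nonempty V] [Fintype B]
    (G : SimpleGraph V) (D : SimpleGraph B) [DecidableRel D.Adj]
    (𝒟 : SimpleGraph.Decomposition G D) (hD : D.IsPlanar) (k : ℕ) (hk : 𝒟.width = k) :
    G.minorCrossingNumber <
      ((k ^ 3 * (k + 1) * (D.maxDegree + 1) ^ 2 * Fintype.card B : ℕ) : ℕ∞) := by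
  obtain ⟨P⟩ := hD.nonempty_polygonalDrawing
  have hbag : ∀ X, (𝒟.bag X).card ≤ k := fun X => by
    rw [← hk]
    exact Finset.le_sup (f := fun X => (𝒟.bag X).card) (Finset.mem_univ X)
  obtain ⟨v⟩ := ‹Nonempty V›
  obtain ⟨X, hX⟩ := (𝒟.connected v).nonempty
  have hk0 : 0 < k := (Finset.card_pos.2 ⟨v, hX⟩).trans_le (hbag X)
  have hB : 0 < Fintype.card B := Fintype.card_pos_iff.2 ⟨X⟩
  obtain ⟨d, hd⟩ := P.exists_drawing_blowup hbag
  refine ((P.minorCrossingNumber_le 𝒟 d).trans hd).trans_lt ?_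
  -- counting ordered pairs gives `k ^ 4`, and the inequality is strict as bags are not all empty
  have h3 : k ^ 4 < k ^ 3 * (k + 1) := by
    rw [mul_add, mul_one, ← pow_succ]
    exact Nat.lt_add_of_pos_right (pow_pos hk0 3)
  have h := Nat.mul_lt_mul_of_pos_right
    (Nat.mul_lt_mul_of_pos_right h3 (pow_pos (Nat.succ_pos D.maxDegree) 2)) hB
  exact_mod_cast h
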